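/- **Setting.** Let $n\ge 1$, let $n_1,\dots,n_N\in\mathbb R^n$ be unit vectors, $G_i=\{x: x\cdot n_i\ge 0\}$, $G=\bigcap_{i=1}^N G_i$, and assume that the origin is a proper vertex of $G$: there is a unit vector $e$ with $G\cap\{x: x\cdot e\le 0\}=\{0\}$. Put $F_i=\partial G\cap\partial G_i$. Let $d_1,\dots,d_N$ be unit vectors with $d_i\cdot n_i>0$. For $I\subset\{1,\dots,N\}$ let $\mathrm{cone}\{w_i,i\in I\}=\{\sum_{i\in I}\alpha_iw_i:\alpha_i\ge0\}$; let $\mathrm{In}(x)=\{i:x\cdot n_i=0\}$, let $d(x)$ be the set of unit vectors in $\mathrm{cone}\{d_i,i\in\mathrm{In}(x)\}$, and let $\mathcal C=\mathrm{cone}\{-d_i: i=1,\dots,N\}$. A pair $(\phi,\eta)$ of càdlàg paths $[0,\infty)\to\mathbb R^n$ solves the Skorohod problem for a càdlàg path $\psi$ with $\psi(0)\in G$ if $\phi(0)=\psi(0)$ and, for all $t$: $\phi(t)=\psi(t)+\eta(t)\in G$; the total variation $|\eta|(t)$ of $\eta$ on $[0,t]$ is finite; $|\eta|(t)=\int_{[0,t]}1_{\{\phi(s)\in\partial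 G\}}\,d|\eta|(s)$; and there is a Borel $\gamma$, not depending on $t$, with $\gamma\in d(\phi)$ $d|\eta|$-a.e. and $\eta(t)=\int_{[0,t]}\gamma\,d|\eta|$. Assume: * (A) for every nonempty $\lambda\subset\{1,\dots,N\}$ a vector $d^\lambda\in\mathrm{cone}\{d_i,i\in\lambda\}$ is fixed such that $d^\lambda\cdot n_i>0$ for all $i\in\lambda$; * (B) for every càdlàg $\psi$ with $\psi(0)\in G$ the Skorohod problem has a unique solution $(\phi,\eta)$, and, writing $\Gamma(\psi)=\phi$, there is $\ell<\infty$ with $\sup_{t\ge0}|\Gamma(\psi_1)(t)-\Gamma(\psi_2)(t)|\le\ell\sup_{t\ge0}|\psi_1(t)-\psi_2(t)|$ for all such $\psi_1,\psi_2$; * (C) $\mathcal C_1$ is a compact subset of the interior of $\mathcal C$. Let $\rho\in C^\infty(\mathbb R^n)$ be nonnegative, supported in $\{|x|\le1\}$, with $\int\rho=1$, and let $g\in C^\infty(\mathbb R;[0,1])$ satisfy $g=1$ on $[0,\frac12]$ and $g=0$ on $[1,\infty)$. With $\lambda(x)=\{i:x\cdot n_i\le0\}$, put $v(\beta,x)=\beta$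 for $x\in G$ and $v(\beta,x)=d^{\lambda(x)}$ for $x\notin G$. For $a>0$, $\beta\in\mathbb R^n$ and $x\ne0$ put $$v^a(\beta,x)=\frac1{(a|x|)^n}\int_{\mathbb R^n}\rho\Big(\frac{x-y}{a|x|}\Big)v(\beta,y)\,dy,$$ $$v^a_i(\beta,x)=g\Big(\frac{\mathrm{dist}(x,F_i)}{a|x|}\Big)d_i+\Big[1-g\Big(\frac{\mathrm{dist}(x,F_i)}{a|x|}\Big)\Big]v^a(\beta,x)\quad(1\le i\le N),$$ $$v^a_0(\beta,x)=g\Big(\frac{\mathrm{dist}(x,G)}{a|x|}\Big)\beta+\Big[1-g\Big(\frac{\mathrm{dist}(x,G)}{a|x|}\Big)\Big]v^a(\beta,x),$$ and $v^a_i(\beta,0)=0$ for $0\le i\le N$. Let $K^a(x)=\bigcup_{\beta\in\mathcal C_1}\mathrm{conv}\{v^a_i(\beta,x):i=0,1,\dots,N\}$. **Proposition 4.3.** There exist $a_0,T\in(0,\infty)$ such that the following hold. 1. Let $a\in(0,a_0)$, $m\in\mathbb Z$, and let $\phi:[0,\infty)\to\mathbb R^n$ be absolutely continuous on bounded intervals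 with $\dot\phi(t)\in K^a(\phi(t))$ for a.e. $t\in[0,\infty)$ and $|\phi(0)|\le2^m$. Then $\phi(t)=0$ for all $t\ge2^{m+1}T$. 2. There is $r\in(0,1)$ such that for every $a\in(0,a_0)$ and every $\phi:[0,\infty)\to\mathbb R^n$ absolutely continuous on bounded intervals with $\dot\phi(t)\in K^a(\phi(t))$ for a.e. $t\in[0,\infty)$ and $|\phi(0)|\le r$, one has $\sup_{0\le t<\infty}|\phi(t)|\le1$. -/

import Mathlib

open MeasureTheory Set Filter Topology
open scoped NNReal ContDiff

noncomputable section

namespace ConstrainedCone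

/-- Euclidean space `ℝⁿ` with its Euclidean norm. -/
abbrev E (n : ℕ) : Type := EuclideanSpace ℝ (Fin n)

variable {n N : ℕ}

/-! ### The polyhedral cone and the constraint directions -/

/-- The half space `G_i = {x : x · ν ≥ 0}` with normal `ν`. -/
def halfSpace (ν : E n) : Set (E n) := {x | 0 ≤ inner ℝ x ν}

/-- The polyhedral cone `G = ⋂ i, G_i`. -/
def polyCone (nrm : Fin N → E n) : Set (E n) := ⋂ i, halfSpace (nrm i)

/-- The face `F_i = ∂G ∩ ∂G_i`. -/
def face (nrm : Fin N → E n) (i : Fin N) : Set (E n) :=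
  frontier (polyCone nrm) ∩ frontier (halfSpace (nrm i))

/-- The origin is a proper vertex of `G`: some closed half space `G₀` (with the origin on its
boundary) meets `G` only at the origin. -/
def ProperVertex (nrm : Fin N → E n) : Prop :=
  ∃ e : E n, ‖e‖ = 1 ∧ polyCone nrm ∩ {x | inner ℝ x e ≤ 0} = {0}

/-- `cone {w_i, i ∈ I}`: nonnegative combinations of the vectors `w i`, `i ∈ I`. -/
def coneGen (w : Fin N → E n) (I : Finset (Fin N)) : Set (E n) :=
  {v | ∃ α : Fin N → ℝ, (∀ i ∈ I, 0 ≤ α i) ∧ v = ∑ i ∈ I, α i • w i}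

open Classical in
/-- `In(x) = {i : x · n_i = 0}`. -/
def activeSet (nrm : Fin N → E n) (x : E n) : Finset (Fin N) :=
  Finset.univ.filter fun i => inner ℝ x (nrm i) = 0

/-- The constraint vector field `d(x)`: unit vectors in `cone {d_i, i ∈ In(x)}`. -/
def constraintField (nrm d : Fin N → E n) (x : E n) : Set (E n) :=
  coneGen d (activeSet nrm x) ∩ Metric.sphere 0 1

/-- The cone `𝒞 = cone {-d_i, i = 1, …, N}`. -/
def stabilityCone (d : Fin N → E n) : Set (E n) := coneGen (fun i => -d i) Finset.univ

/-! ### The Skorohod problem -/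

/-- Right continuous paths on `[0, ∞)` with left limits. -/
def IsCadlag (f : ℝ≥0 → E n) : Prop :=
  ∀ t, ContinuousWithinAt f (Ici t) t ∧ ∃ l, Tendsto f (𝓝[<] t) (𝓝 l)

/-- `(φ, η)` solves the Skorohod problem for `ψ` with respect to `G` and `d`. Here
`eVariationOn η (Iic t)` is the total variation `|η|(t)` of `η` on `[0, t]`, and `μ` is the
(unique) measure `d|η|` on `[0, ∞)` with distribution function `|η|`. -/
def SolvesSP (nrm d : Fin N → E n) (ψ φ η : ℝ≥0 → E n) : Prop :=
  IsCadlag φ ∧ IsCadlag η ∧ φ 0 = ψ 0 ∧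
  (∀ t, φ t = ψ t + η t) ∧
  (∀ t, φ t ∈ polyCone nrm) ∧
  (∀ t, eVariationOn η (Iic t) < ⊤) ∧
  ∃ μ : Measure ℝ≥0, (∀ t, μ (Iic t) = eVariationOn η (Iic t)) ∧
    (∀ t, eVariationOn η (Iic t) =
      ∫⁻ s in Iic t, {s | φ s ∈ frontier (polyCone nrm)}.indicator 1 s ∂μ) ∧
    ∃ γ : ℝ≥0 → E n, Measurable γ ∧
      (∀ᵐ t ∂μ, γ t ∈ constraintField nrm d (φ t)) ∧
      ∀ t, η t = ∫ s in Iic t, γ s ∂μ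

/-- Regularity of the Skorohod map: for every càdlàg `ψ` with `ψ 0 ∈ G` the Skorohod problem has
a unique solution `(φ, η)`, and `ψ ↦ φ` is Lipschitz for the supremum norm on `[0, ∞)`. -/
def SkorohodRegular (nrm d : Fin N → E n) : Prop :=
  (∀ ψ : ℝ≥0 → E n, IsCadlag ψ → ψ 0 ∈ polyCone nrm →
    ∃! p : (ℝ≥0 → E n) × (ℝ≥0 → E n), SolvesSP nrm d ψ p.1 p.2) ∧
  ∃ ℓ : ℝ≥0, ∀ ψ₁ ψ₂ φ₁ φ₂ η₁ η₂ : ℝ≥0 → E n,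
    IsCadlag ψ₁ → ψ₁ 0 ∈ polyCone nrm → IsCadlag ψ₂ → ψ₂ 0 ∈ polyCone nrm →
    SolvesSP nrm d ψ₁ φ₁ η₁ → SolvesSP nrm d ψ₂ φ₂ η₂ →
    ⨆ t, edist (φ₁ t) (φ₂ t) ≤ (ℓ : ENNReal) * ⨆ t, edist (ψ₁ t) (ψ₂ t)

/-! ### The smoothed velocity sets `K^a(x)` -/

open Classical in
/-- `λ(x) = {i : x · n_i ≤ 0}`. -/
def outerSet (nrm : Fin N → E n) (x : E n) : Finset (Fin N) :=
  Finset.univ.filter fun i => inner ℝ x (nrm i) ≤ 0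

open Classical in
/-- `v(β, x)`: equal to `β` on `G` and to `d^{λ(x)}` off `G`. -/
def vel (nrm : Fin N → E n) (dl : Finset (Fin N) → E n) (β x : E n) : E n :=
  if x ∈ polyCone nrm then β else dl (outerSet nrm x)

/-- `v^a(β, x) = (a|x|)^{-n} ∫ ρ((x - y) / (a|x|)) v(β, y) dy`, used for `x ≠ 0`. -/
def velMoll (nrm : Fin N → E n) (dl : Finset (Fin N) → E n) (ρ : E n → ℝ) (a : ℝ)
    (β x : E n) : E n :=
  (1 / (a * ‖x‖) ^ n) • ∫ y, ρ ((1 / (a * ‖x‖)) • (x - y)) • vel nrm dl β y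

open Classical in
/-- `v_i^a(β, x)`, `i = 1, …, N`. -/
def velFace (nrm d : Fin N → E n) (dl : Finset (Fin N) → E n) (ρ : E n → ℝ) (g : ℝ → ℝ)
    (a : ℝ) (β x : E n) (i : Fin N) : E n :=
  if x = 0 then 0 else
    g (Metric.infDist x (face nrm i) / (a * ‖x‖)) • d i +
      (1 - g (Metric.infDist x (face nrm i) / (a * ‖x‖))) • velMoll nrm dl ρ a β x

open Classical in
/-- `v_0^a(β, x)`. -/
def velZero (nrm : Fin N → E n) (dl : Finset (Fin N) → E n) (ρ : E n → ℝ) (g : ℝ → ℝ)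
    (a : ℝ) (β x : E n) : E n :=
  if x = 0 then 0 else
    g (Metric.infDist x (polyCone nrm) / (a * ‖x‖)) • β +
      (1 - g (Metric.infDist x (polyCone nrm) / (a * ‖x‖))) • velMoll nrm dl ρ a β x

/-- `K^a(β, x) = conv {v_i^a(β, x) : i = 0, 1, …, N}`. -/
def velHull (nrm d : Fin N → E n) (dl : Finset (Fin N) → E n) (ρ : E n → ℝ) (g : ℝ → ℝ)
    (a : ℝ) (β x : E n) : Set (E n) :=
  convexHull ℝ (insert (velZero nrm dl ρ g a β x) (range (velFace nrm d dl ρ g a β x)))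

/-- `K^a(x) = ⋃_{β ∈ 𝒞₁} K^a(β, x)`. -/
def velSet (nrm d : Fin N → E n) (dl : Finset (Fin N) → E n) (ρ : E n → ℝ) (g : ℝ → ℝ)
    (C₁ : Set (E n)) (a : ℝ) (x : E n) : Set (E n) :=
  ⋃ β ∈ C₁, velHull nrm d dl ρ g a β x

/-- `φ` is absolutely continuous on `[0, T]` for every `T ≥ 0`, and `φ̇(t) ∈ K(φ(t))` for almost
every `t ∈ [0, ∞)`. -/
def SolvesInclusion (K : E n → Set (E n)) (φ : ℝ → E n) : Prop :=
  (∀ T : ℝ, 0 ≤ T → AbsolutelyContinuousOnInterval φ 0 T) ∧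
  ∀ᵐ t ∂volume.restrict (Ici (0 : ℝ)), ∃ u ∈ K (φ t), HasDerivAt φ u t

end ConstrainedCone

end

noncomputable section

namespace ConstrainedCone

variable {n N : ℕ}

/-! ### Step paths -/

/-! A solution of the smoothed inclusion is compared, after discretization, with the Skorohod
solution that rests at the vertex.

Off `G` the velocities push inwards at a uniform rate, so after a time proportional to `‖φ 0‖` the
path stays relatively close to `G` (`near_of_le`). From then on each short increment is elapsed time
times `σ • β + r`, where `β` is a drift with a `δ`-ball around it in the stability cone, and `r` is
a reaction along nearly active constraints (`velSet_subset_convexHull`, `exists_increment_eq_smul`).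
Replacing sampled points by nearby points of `G` at which those constraints are exactly active
(`exists_face_approx`) yields a genuine step solution of the Skorohod problem (`solvesSP_step`).

At the vertex every constraint is active, so any drift `β` can be cancelled there by a reaction. The
Lipschitz property then gives `‖φ t‖ ≤ 2ℓ‖φ s₀‖`. The room `δ` gives more: the path may be
multiplied by a weight that grows with the amount `A` of drift used, since the extra increments are
absorbed by perturbing `β` by at most `δ`. Hence `‖φ‖` decays as `A` grows (`weighted_bound`).
Moreover `A` must grow linearly in time: a functional `f` positive on all `d i`
(`exists_functional_pos`) increases under pure reaction, yet is controlled by the bounded norm. So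
the norm halves in time proportional to its size (`norm_le_half`), and a geometric series bounds the
hitting time (`exists_hitting_time`). -/

theorem floor_eventuallyEq_right (t : ℝ≥0) : ∀ᶠ s in 𝓝[≥] t, ⌊s⌋₊ = ⌊t⌋₊ := by
  have h : Iio ((⌊t⌋₊ : ℝ≥0) + 1) ∈ 𝓝[≥] t :=
    mem_nhdsWithin_of_mem_nhds (Iio_mem_nhds (Nat.lt_floor_add_one t))
  filter_upwards [h, self_mem_nhdsWithin] with s hs hts
  rw [Nat.floor_eq_iff zero_le]
  exact ⟨(Nat.floor_le zero_le).trans hts, hs⟩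

theorem floor_eventuallyConst_left (t : ℝ≥0) : ∃ m : ℕ, ∀ᶠ s in 𝓝[<] t, ⌊s⌋₊ = m := by
  rcases eq_or_lt_of_le (zero_le : 0 ≤ t) with h | h
  · refine ⟨0, ?_⟩
    have : Iio t = ∅ := by ext s; simp [← h]
    simp [this]
  · have hc : 0 < ⌈t⌉₊ := Nat.ceil_pos.2 h
    -- At an integer `t` the left limit takes the preceding value, hence the ceiling minus one
    -- rather than the floor.
    refine ⟨⌈t⌉₊ - 1, ?_⟩
    have h1 : ((⌈t⌉₊ - 1 : ℕ) : ℝ≥0) < t := Nat.lt_ceil.1 (by omega)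
    have h2 : Ioi ((⌈t⌉₊ - 1 : ℕ) : ℝ≥0) ∈ 𝓝[<] t :=
      mem_nhdsWithin_of_mem_nhds (Ioi_mem_nhds h1)
    filter_upwards [h2, self_mem_nhdsWithin] with s hs hst
    rw [Nat.floor_eq_iff zero_le]
    refine ⟨le_of_lt hs, (lt_of_lt_of_le hst (Nat.le_ceil t)).trans_le ?_⟩
    rw [← Nat.cast_add_one]
    exact_mod_cast (by omega : ⌈t⌉₊ ≤ ⌈t⌉₊ - 1 + 1)

theorem isCadlag_comp_floor (X : ℕ → E n) : IsCadlag fun t : ℝ≥0 => X ⌊t⌋₊ := by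
  intro t
  constructor
  · refine tendsto_const_nhds.congr' ?_
    filter_upwards [floor_eventuallyEq_right t] with s hs
    rw [hs]
  · obtain ⟨m, hm⟩ := floor_eventuallyConst_left t
    refine ⟨X m, tendsto_const_nhds.congr' ?_⟩
    filter_upwards [hm] with s hs
    rw [hs]

theorem eVariationOn_nat_Iic (S : ℕ → E n) (m : ℕ) :
    eVariationOn S (Iic m) = ∑ k ∈ Finset.range m, edist (S k) (S (k + 1)) := by
  have h := eVariationOn.sum' S (I := fun k => k) monotone_id (n := m)
  have h0 : Iic m = Icc 0 m := by ext; simp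
  rw [h0, ← h]
  refine Finset.sum_congr rfl fun k _ => ?_
  have : Icc k (k + 1) = {k, k + 1} := by ext j; simp; omega
  rw [this, eVariationOn.pair]

theorem eVariationOn_comp_floor (S : ℕ → E n) (t : ℝ≥0) :
    eVariationOn (fun t : ℝ≥0 => S ⌊t⌋₊) (Iic t) =
      ∑ k ∈ Finset.range ⌊t⌋₊, edist (S k) (S (k + 1)) := by
  have h := eVariationOn.comp_eq_of_monotoneOn S (t := Iic t) (fun t : ℝ≥0 => ⌊t⌋₊)
    (Nat.floor_mono.monotoneOn _)
  have h2 : (fun t : ℝ≥0 => ⌊t⌋₊) '' Iic t = Iic ⌊t⌋₊ := by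
    ext m
    constructor
    · rintro ⟨s, hs, rfl⟩
      exact Nat.floor_mono hs
    · intro hm
      exact ⟨m, (Nat.le_floor_iff zero_le).1 hm, by simp⟩
  rw [h2, eVariationOn_nat_Iic] at h
  exact h

/-- The jump measure of a step path with jump `h k` at time `k + 1`. -/
def jumpMeasure (h : ℕ → E n) : Measure ℝ≥0 :=
  Measure.sum fun k => ‖h k‖ₑ • Measure.dirac ((k : ℝ≥0) + 1)

theorem jumpMeasure_restrict (h : ℕ → E n) (t : ℝ≥0) :
    (jumpMeasure h).restrict (Iic t) =
      ∑ k ∈ Finset.range ⌊t⌋₊, ‖h k‖ₑ • Measure.dirac ((k : ℝ≥0) + 1) := by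
  ext s hs
  rw [Measure.restrict_apply hs, jumpMeasure, Measure.sum_apply _ (hs.inter measurableSet_Iic),
    Measure.finsetSum_apply, tsum_eq_sum (s := Finset.range ⌊t⌋₊)]
  · refine Finset.sum_congr rfl fun k hk => ?_
    have hk' : (k : ℝ≥0) + 1 ≤ t := by
      have := (Nat.le_floor_iff zero_le).1 (Nat.succ_le_of_lt (Finset.mem_range.1 hk))
      simpa using this
    simp only [Measure.smul_apply, Measure.dirac_apply' _ hs,
      Measure.dirac_apply' _ (hs.inter measurableSet_Iic)]
    congr 1
    by_cases h1 : (k : ℝ≥0) + 1 ∈ s <;> simp [h1, hk']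
  · intro k hk
    have hk' : ¬ (k : ℝ≥0) + 1 ≤ t := by
      intro hle
      apply hk
      rw [Finset.mem_range]
      apply Nat.lt_of_succ_le
      rw [Nat.le_floor_iff zero_le]
      simpa using hle
    simp only [Measure.smul_apply, Measure.dirac_apply' _ (hs.inter measurableSet_Iic)]
    simp [hk']

theorem ae_jumpMeasure {h : ℕ → E n} {p : ℝ≥0 → Prop}
    (hp : ∀ k, h k ≠ 0 → p ((k : ℝ≥0) + 1)) : ∀ᵐ t ∂jumpMeasure h, p t := by
  rw [jumpMeasure, Measure.ae_sum_iff]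
  intro k
  by_cases hk : h k = 0
  · simp [hk]
  · exact Measure.ae_smul_measure ((ae_dirac_eq (a := (k : ℝ≥0) + 1)).symm ▸ hp k hk) _

/-! ### Elementary facts on polyhedral and generated cones -/

theorem isClosed_polyCone (nrm : Fin N → E n) : IsClosed (polyCone nrm) :=
  isClosed_iInter fun _ => isClosed_le continuous_const
    (continuous_id.inner continuous_const)

theorem mem_polyCone {nrm : Fin N → E n} {x : E n} :
    x ∈ polyCone nrm ↔ ∀ i, 0 ≤ inner ℝ x (nrm i) := by
  simp [polyCone, halfSpace]

theorem mem_activeSet {nrm : Fin N → E n} {x : E n} {i : Fin N} :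
    i ∈ activeSet nrm x ↔ inner ℝ x (nrm i) = 0 := by
  simp [activeSet]

/-- Moving from `x` in the direction `-nrm i` leaves the cone at once. -/
theorem mem_frontier_polyCone {nrm : Fin N → E n} {x : E n} {i : Fin N} (hi : nrm i ≠ 0)
    (hx : x ∈ polyCone nrm) (h0 : inner ℝ x (nrm i) = 0) : x ∈ frontier (polyCone nrm) := by
  rw [(isClosed_polyCone nrm).frontier_eq]
  refine ⟨hx, fun hint => ?_⟩
  have hc : Tendsto (fun t : ℝ => x - t • nrm i) (𝓝 0) (𝓝 x) := by
    have : Continuous fun t : ℝ => x - t • nrm i := by fun_prop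
    simpa using this.tendsto 0
  have h1 : ∀ᶠ t : ℝ in 𝓝[>] 0, x - t • nrm i ∈ polyCone nrm :=
    (hc.eventually (mem_interior_iff_mem_nhds.1 hint)).filter_mono nhdsWithin_le_nhds
  obtain ⟨t, ht, ht0⟩ := (h1.and self_mem_nhdsWithin).exists
  have h2 := mem_polyCone.1 ht i
  rw [inner_sub_left, h0, inner_smul_left, real_inner_self_eq_norm_sq] at h2
  have h3 : 0 < ‖nrm i‖ ^ 2 := by positivity
  have h4 : 0 < t * ‖nrm i‖ ^ 2 := mul_pos ht0 h3
  simp at h2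
  linarith

theorem smul_mem_coneGen {w : Fin N → E n} {I : Finset (Fin N)} {v : E n} {c : ℝ} (hc : 0 ≤ c)
    (hv : v ∈ coneGen w I) : c • v ∈ coneGen w I := by
  obtain ⟨α, hα, rfl⟩ := hv
  exact ⟨fun i => c * α i, fun i hi => mul_nonneg hc (hα i hi), by
    rw [Finset.smul_sum]; simp [mul_smul]⟩

theorem add_mem_coneGen {w : Fin N → E n} {I : Finset (Fin N)} {u v : E n}
    (hu : u ∈ coneGen w I) (hv : v ∈ coneGen w I) : u + v ∈ coneGen w I := by
  obtain ⟨α, hα, rfl⟩ := hu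
  obtain ⟨β, hβ, rfl⟩ := hv
  exact ⟨fun i => α i + β i, fun i hi => add_nonneg (hα i hi) (hβ i hi), by
    rw [← Finset.sum_add_distrib]; simp [add_smul]⟩

theorem zero_mem_coneGen (w : Fin N → E n) (I : Finset (Fin N)) : (0 : E n) ∈ coneGen w I :=
  ⟨0, by simp, by simp⟩

theorem coneGen_mono {w : Fin N → E n} {I J : Finset (Fin N)} (hIJ : I ⊆ J) :
    coneGen w I ⊆ coneGen w J := by
  classical
  rintro v ⟨α, hα, rfl⟩
  refine ⟨fun i => if i ∈ I then α i else 0, fun i _ => ?_, ?_⟩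
  · dsimp only
    split_ifs with h
    exacts [hα i h, le_rfl]
  · simp only [ite_smul, zero_smul]
    rw [Finset.sum_ite_mem, Finset.inter_eq_right.2 hIJ]

theorem convex_coneGen (w : Fin N → E n) (I : Finset (Fin N)) : Convex ℝ (coneGen w I) :=
  fun _ hu _ hv _ _ ha hb _ =>
    add_mem_coneGen (smul_mem_coneGen ha hu) (smul_mem_coneGen hb hv)

theorem neg_mem_stabilityCone {d : Fin N → E n} {v : E n} :
    -v ∈ stabilityCone d ↔ v ∈ coneGen d Finset.univ := by
  constructor <;> rintro ⟨α, hα, h⟩ <;> refine ⟨α, hα, ?_⟩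
  · rw [← neg_inj, h]; simp
  · rw [h]; simp

/-- Step paths moving inside the cone, whose reaction jumps lie in the cones generated by the
active constraint directions, solve the Skorohod problem. -/
theorem solvesSP_step {nrm d : Fin N → E n} (hnrm : ∀ i, ‖nrm i‖ = 1) {X h : ℕ → E n}
    (hX : ∀ k, X k ∈ polyCone nrm) (hh : ∀ k, h k ∈ coneGen d (activeSet nrm (X (k + 1)))) :
    SolvesSP nrm d (fun t => X ⌊t⌋₊ - ∑ j ∈ Finset.range ⌊t⌋₊, h j) (fun t => X ⌊t⌋₊)
      (fun t => ∑ j ∈ Finset.range ⌊t⌋₊, h j) := by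
  have hvar : ∀ t : ℝ≥0, eVariationOn (fun t : ℝ≥0 => ∑ j ∈ Finset.range ⌊t⌋₊, h j) (Iic t) =
      ∑ k ∈ Finset.range ⌊t⌋₊, ‖h k‖ₑ := by
    intro t
    rw [eVariationOn_comp_floor (fun m => ∑ j ∈ Finset.range m, h j)]
    refine Finset.sum_congr rfl fun k _ => ?_
    rw [Finset.sum_range_succ, edist_comm, edist_eq_enorm_sub]
    simp
  have hfl : ∀ k : ℕ, ⌊(k : ℝ≥0) + 1⌋₊ = k + 1 := fun k => by
    rw [← Nat.cast_add_one, Nat.floor_natCast]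
  -- A nonzero reaction needs some active constraint, and this places the point on the boundary.
  have hfr : ∀ k, h k ≠ 0 → X (k + 1) ∈ frontier (polyCone nrm) := by
    intro k hk
    obtain ⟨α, -, hα⟩ := hh k
    obtain ⟨i, hi⟩ : (activeSet nrm (X (k + 1))).Nonempty := by
      rw [Finset.nonempty_iff_ne_empty]
      intro h0
      rw [h0] at hα
      exact hk (by simpa using hα)
    have hi0 : nrm i ≠ 0 := by
      intro h0
      simpa [h0] using hnrm i
    exact mem_frontier_polyCone hi0 (hX _) (mem_activeSet.1 hi)
  -- The jump at time `k + 1` is `h k`, hence the index `⌊t⌋₊ - 1` in the direction field; its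
  -- values at times not charged by `jumpMeasure h` are immaterial.
  refine ⟨isCadlag_comp_floor X, isCadlag_comp_floor fun m => ∑ j ∈ Finset.range m, h j,
    by simp, fun t => by simp, fun t => hX _, fun t => ?_, jumpMeasure h, fun t => ?_, fun t => ?_,
    fun t => ‖h (⌊t⌋₊ - 1)‖⁻¹ • h (⌊t⌋₊ - 1), ?_, ?_, fun t => ?_⟩
  · rw [hvar]
    exact ENNReal.sum_lt_top.2 fun k _ => enorm_lt_top
  · rw [hvar, ← Measure.restrict_apply_self, jumpMeasure_restrict, Measure.finsetSum_apply]
    refine Finset.sum_congr rfl fun k hk => ?_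
    have hk' : (k : ℝ≥0) + 1 ≤ t := by
      have := (Nat.le_floor_iff (zero_le : 0 ≤ t)).1
        (Nat.succ_le_of_lt (Finset.mem_range.1 hk))
      simpa using this
    simp [Measure.dirac_apply' _ measurableSet_Iic, hk']
  · rw [lintegral_congr_ae (g := fun _ => 1)]
    · rw [lintegral_one, Measure.restrict_apply_univ, hvar, ← Measure.restrict_apply_self,
        jumpMeasure_restrict, Measure.finsetSum_apply]
      refine Finset.sum_congr rfl fun k hk => ?_
      have hk' : (k : ℝ≥0) + 1 ≤ t := by
        have := (Nat.le_floor_iff (zero_le : 0 ≤ t)).1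
          (Nat.succ_le_of_lt (Finset.mem_range.1 hk))
        simpa using this
      simp [Measure.dirac_apply' _ measurableSet_Iic, hk']
    · refine ae_restrict_of_ae (ae_jumpMeasure fun k hk => ?_)
      have : (k : ℝ≥0) + 1 ∈ {s : ℝ≥0 | X ⌊s⌋₊ ∈ frontier (polyCone nrm)} := by
        simp only [mem_ofPred_eq, hfl]
        exact hfr k hk
      rw [indicator_of_mem this, Pi.one_apply]
  · exact (measurable_from_nat (f := fun m : ℕ => ‖h (m - 1)‖⁻¹ • h (m - 1))).comp
      Nat.measurable_floor
  · refine ae_jumpMeasure fun k hk => ?_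
    simp only [hfl, Nat.add_sub_cancel]
    refine ⟨smul_mem_coneGen (by positivity) (hh k), ?_⟩
    simp [norm_smul, hk]
  · rw [jumpMeasure_restrict, integral_finsetSum_measure]
    · refine Finset.sum_congr rfl fun k _ => ?_
      rw [integral_smul_measure, integral_dirac]
      simp only [hfl, Nat.add_sub_cancel, toReal_enorm]
      by_cases hk : h k = 0
      · simp [hk]
      · rw [smul_smul, mul_inv_cancel₀ (norm_ne_zero_iff.2 hk), one_smul]
    · intro k _
      exact (integrable_dirac (by simp)).smul_measure enorm_ne_top

/-- Discrete consequence of the Lipschitz property of the Skorohod map, comparing a step solution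
with the solution resting at the vertex. -/
theorem SkorohodRegular.exists_discrete_bound {nrm d : Fin N → E n} (hnrm : ∀ i, ‖nrm i‖ = 1)
    (hreg : SkorohodRegular nrm d) :
    ∃ ℓ : ℝ, 1 ≤ ℓ ∧ ∀ (X h h' : ℕ → E n) (D : ℝ), (∀ k, X k ∈ polyCone nrm) →
      (∀ k, h k ∈ coneGen d (activeSet nrm (X (k + 1)))) →
      (∀ k, h' k ∈ coneGen d Finset.univ) →
      (∀ k, ‖X k - ∑ j ∈ Finset.range k, (h j - h' j)‖ ≤ D) → ∀ k, ‖X k‖ ≤ ℓ * D := by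
  obtain ⟨-, ℓ, hℓ⟩ := hreg
  refine ⟨max ℓ 1, le_max_right _ _, fun X h h' D hX hh hh' hD k => ?_⟩
  have hD0 : 0 ≤ D := (norm_nonneg _).trans (hD 0)
  have h0G : (0 : E n) ∈ polyCone nrm := mem_polyCone.2 fun i => by simp
  -- All constraints are active at the vertex, so every `h' k` in the full cone is an admissible
  -- reaction there.
  have h0 : activeSet nrm (0 : E n) = Finset.univ := by
    ext i; simp [mem_activeSet]
  have key := hℓ _ _ _ _ _ _
    (isCadlag_comp_floor fun m => X m - ∑ j ∈ Finset.range m, h j) (by simpa using hX 0)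
    (isCadlag_comp_floor fun m => (0 : E n) - ∑ j ∈ Finset.range m, h' j) (by simpa using h0G)
    (solvesSP_step hnrm hX hh) (solvesSP_step (X := fun _ => (0 : E n)) hnrm (fun _ => h0G)
      (fun k => by simpa only [h0] using hh' k))
  have h1 : ⨆ t : ℝ≥0, edist (X ⌊t⌋₊ - ∑ j ∈ Finset.range ⌊t⌋₊, h j)
      ((0 : E n) - ∑ j ∈ Finset.range ⌊t⌋₊, h' j) ≤ ENNReal.ofReal D := by
    refine iSup_le fun t => ?_
    rw [edist_dist, dist_eq_norm]
    refine ENNReal.ofReal_le_ofReal ?_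
    have h3 : X ⌊t⌋₊ - ∑ j ∈ Finset.range ⌊t⌋₊, h j - (0 - ∑ j ∈ Finset.range ⌊t⌋₊, h' j) =
        X ⌊t⌋₊ - ∑ j ∈ Finset.range ⌊t⌋₊, (h j - h' j) := by
      rw [Finset.sum_sub_distrib]
      abel
    rw [h3]
    exact hD _
  have h2 : edist (X ⌊(k : ℝ≥0)⌋₊) 0 ≤ (ℓ : ENNReal) * ENNReal.ofReal D :=
    (le_iSup (fun t : ℝ≥0 => edist (X ⌊t⌋₊) (0 : E n)) (k : ℝ≥0)).trans
      (key.trans (by gcongr))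
  rw [Nat.floor_natCast, edist_dist, dist_zero_right, ← ENNReal.ofReal_coe_nnreal,
    ← ENNReal.ofReal_mul ℓ.coe_nonneg,
    ENNReal.ofReal_le_ofReal_iff (mul_nonneg ℓ.coe_nonneg hD0)] at h2
  exact h2.trans (by gcongr; exact le_max_left _ _)

/-! ### Consequences of the existence of the vectors `d^λ` -/

/-- Some normal of the support sees a nonzero nonnegative combination of the `d_j` positively. -/
theorem exists_inner_pos {nrm d : Fin N → E n} {dl : Finset (Fin N) → E n}
    (hdl : ∀ lam : Finset (Fin N), lam.Nonempty →
      dl lam ∈ coneGen d lam ∧ ∀ i ∈ lam, 0 < inner ℝ (dl lam) (nrm i))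
    (S : Finset (Fin N)) (hS : S.Nonempty) (z : Fin N → ℝ) (hz : ∀ i ∈ S, 0 < z i) :
    ∃ k ∈ S, 0 < inner ℝ (∑ j ∈ S, z j • d j) (nrm k) := by
  induction S using Finset.strongInduction generalizing z with
  | H S ih =>
    by_contra! hcon
    obtain ⟨⟨w, hw, hwe⟩, hpos⟩ := hdl S hS
    have hex : ∃ i ∈ S, 0 < w i := by
      by_contra! hall
      obtain ⟨k, hk⟩ := hS
      have h0 : dl S = 0 := by
        rw [hwe]
        refine Finset.sum_eq_zero fun i hi => ?_
        rw [le_antisymm (hall i hi) (hw i hi), zero_smul]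
      have := hpos k hk
      simp [h0] at this
    -- Subtract from the combination the largest multiple `s` of `dl S` that keeps all coefficients
    -- nonnegative. This kills the coefficient of `i0` and makes every inner product strictly
    -- negative, so the induction hypothesis on the smaller support gives a contradiction.
    obtain ⟨i0, hi0, hmin⟩ := (S.filter fun i => 0 < w i).exists_min_image (fun i => z i / w i)
      (by obtain ⟨i, hi, hwi⟩ := hex; exact ⟨i, by simp [hi, hwi]⟩)
    rw [Finset.mem_filter] at hi0
    set s := z i0 / w i0 with hs
    have hs0 : 0 < s := div_pos (hz _ hi0.1) hi0.2
    set z' : Fin N → ℝ := fun i => z i - s * w i with hz'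
    have hz'0 : ∀ i ∈ S, 0 ≤ z' i := by
      intro i hi
      rcases (hw i hi).lt_or_eq with h | h
      · have := hmin i (by simp [hi, h])
        rw [le_div_iff₀ h] at this
        simp only [hz']
        linarith
      · simp only [hz', ← h]
        linarith [hz i hi]
    have hz'i0 : z' i0 = 0 := by
      simp only [hz', hs]
      rw [div_mul_cancel₀ _ hi0.2.ne', sub_self]
    have hsum : ∑ j ∈ S with 0 < z' j, z' j • d j = ∑ j ∈ S, z j • d j - s • dl S := by
      rw [hwe, Finset.smul_sum, ← Finset.sum_sub_distrib, Finset.sum_filter]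
      refine Finset.sum_congr rfl fun i hi => ?_
      rw [smul_smul, ← sub_smul]
      split_ifs with h
      · rfl
      · have : z' i = 0 := le_antisymm (not_lt.1 h) (hz'0 i hi)
        simp only [hz'] at this
        rw [this, zero_smul]
    have hneg : ∀ k ∈ S, inner ℝ (∑ j ∈ S with 0 < z' j, z' j • d j) (nrm k) < 0 := by
      intro k hk
      rw [hsum, inner_sub_left, real_inner_smul_left]
      linarith [hcon k hk, mul_pos hs0 (hpos k hk)]
    rcases (S.filter fun j => 0 < z' j).eq_empty_or_nonempty with he | hne
    · obtain ⟨k, hk⟩ := hS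
      have := hneg k hk
      rw [he] at this
      simp at this
    · obtain ⟨k, hk, hk'⟩ := ih (S.filter fun j => 0 < z' j)
        (Finset.filter_ssubset.2 ⟨i0, hi0.1, by simp [hz'i0]⟩) hne z'
        (fun i hi => (Finset.mem_filter.1 hi).2)
      exact (hneg k (Finset.mem_filter.1 hk).1).not_gt hk'

/-- The constraint directions lie in an open half space. -/
theorem exists_functional_pos {nrm d : Fin N → E n} {dl : Finset (Fin N) → E n}
    (hdl : ∀ lam : Finset (Fin N), lam.Nonempty →
      dl lam ∈ coneGen d lam ∧ ∀ i ∈ lam, 0 < inner ℝ (dl lam) (nrm i)) :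
    ∃ (f : E n →L[ℝ] ℝ) (c : ℝ), 0 < c ∧ ∀ i, c ≤ f (d i) := by
  set K : Set (E n) := (Fintype.linearCombination ℝ d) '' stdSimplex ℝ (Fin N)
  have hKc : Convex ℝ K := (convex_stdSimplex ℝ _).linear_image _
  have hKk : IsCompact K := (isCompact_stdSimplex ℝ _).image
    (LinearMap.continuous_of_finiteDimensional _)
  -- A vanishing convex combination would contradict `exists_inner_pos` on its support; a compact
  -- convex set missing `0` can then be strictly separated from it.
  have h0 : (0 : E n) ∉ K := by
    rintro ⟨z, ⟨hz, hz1⟩, h⟩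
    rw [Fintype.linearCombination_apply] at h
    have hsum : ∑ j with 0 < z j, z j • d j = 0 := by
      rw [← h, Finset.sum_filter]
      refine Finset.sum_congr rfl fun i _ => ?_
      split_ifs with hi
      · rfl
      · rw [le_antisymm (not_lt.1 hi) (hz i), zero_smul]
    have hne : (Finset.univ.filter fun j => 0 < z j).Nonempty := by
      by_contra hemp
      rw [Finset.not_nonempty_iff_eq_empty, Finset.filter_eq_empty_iff] at hemp
      have : ∑ i, z i ≤ 0 := Finset.sum_nonpos fun i hi => not_lt.1 (hemp hi)
      linarith
    obtain ⟨k, -, hk⟩ := exists_inner_pos hdl _ hne z (fun i hi => (Finset.mem_filter.1 hi).2)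
    rw [hsum, inner_zero_left] at hk
    exact lt_irrefl _ hk
  obtain ⟨f, u, hu, hf⟩ := geometric_hahn_banach_point_closed hKc hKk.isClosed h0
  refine ⟨f, u, by simpa using hu, fun i => (hf _ ?_).le⟩
  exact ⟨Pi.single i 1, single_mem_stdSimplex ℝ i, by simp⟩

/-! ### Approximation by points of faces -/

/-- By homogeneity it suffices to treat unit vectors. The penalty `h` measures violation of the
constraints and of the equalities for `I`; it vanishes only on the face `Z`, so by compactness it
has a positive minimum on unit vectors at distance at least `ε` from `Z`. -/
theorem exists_face_approx (nrm : Fin N → E n) (I : Finset (Fin N)) {ε : ℝ} (hε : 0 < ε) :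
    ∃ κ : ℝ, 0 < κ ∧ ∀ x : E n, (∀ i, -(κ * ‖x‖) ≤ inner ℝ x (nrm i)) →
      (∀ i ∈ I, inner ℝ x (nrm i) ≤ κ * ‖x‖) →
      ∃ p ∈ polyCone nrm, (∀ i ∈ I, inner ℝ p (nrm i) = 0) ∧ ‖p - x‖ ≤ ε * ‖x‖ := by
  set Z : Set (E n) := {p | p ∈ polyCone nrm ∧ ∀ i ∈ I, inner ℝ p (nrm i) = 0} with hZ
  have hZ0 : (0 : E n) ∈ Z := ⟨mem_polyCone.2 fun i => by simp, fun i _ => by simp⟩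
  set h : E n → ℝ := fun x => ∑ i, max 0 (-inner ℝ x (nrm i)) +
    ∑ i ∈ I, max 0 (inner ℝ x (nrm i)) with hh
  have hcont : Continuous h := by
    have : ∀ i, Continuous fun x : E n => inner ℝ x (nrm i) := fun i =>
      continuous_id.inner continuous_const
    fun_prop
  set S : Set (E n) := Metric.sphere 0 1 ∩ {x | ε ≤ Metric.infDist x Z}
  have hS : IsCompact S := (isCompact_sphere _ _).inter_right
    (isClosed_le continuous_const (Metric.continuous_infDist_pt Z))
  have hmem : ∀ x, h x ≤ 0 → x ∈ Z := by
    intro x hx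
    have h1 : 0 ≤ ∑ i, max 0 (-inner ℝ x (nrm i)) :=
      Finset.sum_nonneg fun i _ => le_max_left _ _
    have h2 : 0 ≤ ∑ i ∈ I, max 0 (inner ℝ x (nrm i)) :=
      Finset.sum_nonneg fun i _ => le_max_left _ _
    have h3 : ∑ i, max 0 (-inner ℝ x (nrm i)) = 0 := by simp only [hh] at hx; linarith
    have h4 : ∑ i ∈ I, max 0 (inner ℝ x (nrm i)) = 0 := by simp only [hh] at hx; linarith
    rw [Finset.sum_eq_zero_iff_of_nonneg fun i _ => le_max_left _ _] at h3 h4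
    have h5 : ∀ i, 0 ≤ inner ℝ x (nrm i) := fun i => by
      have := h3 i (Finset.mem_univ i)
      rw [max_eq_left_iff] at this
      linarith
    exact ⟨mem_polyCone.2 h5, fun i hi => le_antisymm (max_eq_left_iff.1 (h4 i hi)) (h5 i)⟩
  have hpos : ∃ m : ℝ, 0 < m ∧ ∀ x ∈ S, m ≤ h x := by
    rcases S.eq_empty_or_nonempty with he | hne
    · exact ⟨1, one_pos, by simp [he]⟩
    · obtain ⟨x, hx, hmin⟩ := hS.exists_isMinOn hne hcont.continuousOn
      refine ⟨h x, ?_, fun y hy => hmin hy⟩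
      by_contra hle
      have hxZ := hmem x (not_lt.1 hle)
      have h1 : ε ≤ Metric.infDist x Z := hx.2
      rw [Metric.infDist_zero_of_mem hxZ] at h1
      linarith
  obtain ⟨m, hm, hmS⟩ := hpos
  -- The two sums contain at most `2 * N` terms, each at most `κ`; the extra `1` makes the total
  -- strictly less than `m`.
  refine ⟨m / (2 * N + 1), by positivity, fun x hx1 hx2 => ?_⟩
  rcases eq_or_ne x 0 with rfl | hx0
  · exact ⟨0, hZ0.1, hZ0.2, by simp⟩
  set κ := m / (2 * N + 1) with hκ
  have hκ0 : 0 < κ := by positivity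
  have hxn : 0 < ‖x‖ := norm_pos_iff.2 hx0
  set e := ‖x‖⁻¹ • x with he
  have hen : ‖e‖ = 1 := by simp [he, norm_smul, hx0]
  have hei : ∀ i, inner ℝ e (nrm i) = ‖x‖⁻¹ * inner ℝ x (nrm i) := fun i =>
    real_inner_smul_left _ _ _
  have hle : h e < m := by
    have h1 : ∑ i, max 0 (-inner ℝ e (nrm i)) ≤ ∑ _i : Fin N, κ := by
      refine Finset.sum_le_sum fun i _ => max_le hκ0.le ?_
      rw [hei, ← mul_neg, inv_mul_le_iff₀ hxn]
      linarith [hx1 i]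
    have h2 : ∑ i ∈ I, max 0 (inner ℝ e (nrm i)) ≤ ∑ _i : Fin N, κ := by
      refine (Finset.sum_le_sum fun i hi => max_le hκ0.le ?_).trans
        (Finset.sum_le_sum_of_subset_of_nonneg (Finset.subset_univ I) fun _ _ _ => hκ0.le)
      rw [hei, inv_mul_le_iff₀ hxn]
      linarith [hx2 i hi]
    simp only [Finset.sum_const, Finset.card_univ, Fintype.card_fin, nsmul_eq_mul] at h1 h2
    have h3 : (2 * N + 1) * κ = m := by rw [hκ]; field_simp
    simp only [hh]
    linarith
  have hnot : ¬ ε ≤ Metric.infDist e Z := fun hc =>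
    hle.not_ge (hmS e ⟨by simpa using hen, hc⟩)
  obtain ⟨p, hp, hdist⟩ := (Metric.infDist_lt_iff ⟨0, hZ0⟩).1 (not_le.1 hnot)
  refine ⟨‖x‖ • p, mem_polyCone.2 fun i => ?_, fun i hi => ?_, ?_⟩
  · rw [real_inner_smul_left]
    exact mul_nonneg hxn.le (mem_polyCone.1 hp.1 i)
  · rw [real_inner_smul_left, hp.2 i hi, mul_zero]
  · have : ‖x‖ • p - x = ‖x‖ • (p - e) := by
      rw [smul_sub, he, smul_smul, mul_inv_cancel₀ hxn.ne', one_smul]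
    rw [this, norm_smul, norm_norm, mul_comm]
    rw [dist_comm, dist_eq_norm] at hdist
    gcongr

/-- Points nearly in the cone are close to the face cut out by the nearly active constraints. -/
theorem exists_face_approx_uniform (nrm : Fin N → E n) {ε : ℝ} (hε : 0 < ε) :
    ∃ κ : ℝ, 0 < κ ∧ ∀ (I : Finset (Fin N)) (x : E n),
      (∀ i, -(κ * ‖x‖) ≤ inner ℝ x (nrm i)) → (∀ i ∈ I, inner ℝ x (nrm i) ≤ κ * ‖x‖) →
      ∃ p ∈ polyCone nrm, I ⊆ activeSet nrm p ∧ ‖p - x‖ ≤ ε * ‖x‖ := by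
  choose κ hκ h using fun I => exists_face_approx nrm I hε
  obtain ⟨I₀, -, hI₀⟩ := (Finset.univ : Finset (Finset (Fin N))).exists_min_image κ
    Finset.univ_nonempty
  refine ⟨κ I₀, hκ I₀, fun I x h1 h2 => ?_⟩
  have hle : κ I₀ * ‖x‖ ≤ κ I * ‖x‖ := by gcongr; exact hI₀ I (Finset.mem_univ _)
  obtain ⟨p, hp, hp0, hpx⟩ := h I x (fun i => by linarith [h1 i]) fun i hi => (h2 i hi).trans hle
  exact ⟨p, hp, fun i hi => mem_activeSet.2 (hp0 i hi), hpx⟩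

/-! ### Increments of absolutely continuous paths -/

theorem mul_sub_le_of_absolutelyContinuous {f : ℝ → ℝ} {s t c : ℝ} (hst : s ≤ t)
    (hf : AbsolutelyContinuousOnInterval f s t)
    (hc : ∀ᵐ u ∂volume.restrict (Icc s t), ∃ v, HasDerivAt f v u ∧ c ≤ v) :
    c * (t - s) ≤ f t - f s := by
  rw [← hf.integral_deriv_eq_sub]
  have h := intervalIntegral.integral_mono_ae_restrict (μ := volume) (f := fun _ => c)
    (g := deriv f) hst intervalIntegrable_const hf.intervalIntegrable_deriv
    (by filter_upwards [hc] with u ⟨v, hv, hcv⟩; rwa [hv.deriv])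
  simpa [mul_comm] using h

theorem absolutelyContinuousOnInterval_clm {F : Type*} [NormedAddCommGroup F] [NormedSpace ℝ F]
    {φ : ℝ → F} {s t : ℝ} (hφ : AbsolutelyContinuousOnInterval φ s t) (f : F →L[ℝ] ℝ) :
    AbsolutelyContinuousOnInterval (fun u => f (φ u)) s t := by
  have h : Tendsto (fun E : ℕ × (ℕ → ℝ × ℝ) =>
      ‖f‖ * ∑ i ∈ Finset.range E.1, dist (φ (E.2 i).1) (φ (E.2 i).2))
      (AbsolutelyContinuousOnInterval.totalLengthFilter ⊓
        𝓟 (AbsolutelyContinuousOnInterval.disjWithin s t)) (𝓝 0) := by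
    simpa using Tendsto.const_mul ‖f‖ hφ
  refine squeeze_zero (fun E => Finset.sum_nonneg fun _ _ => dist_nonneg) (fun E => ?_) h
  rw [Finset.mul_sum]
  refine Finset.sum_le_sum fun i _ => ?_
  rw [dist_eq_norm, dist_eq_norm, ← map_sub]
  exact f.le_opNorm _

/-- The increment of an absolutely continuous path is the elapsed time multiplied by an element
of any nonempty closed convex set containing almost all velocities. -/
theorem exists_increment_eq_smul {F : Type*} [NormedAddCommGroup F] [NormedSpace ℝ F]
    {φ : ℝ → F} {s t : ℝ} {W : Set F} (hst : s ≤ t)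
    (hφ : AbsolutelyContinuousOnInterval φ s t) (hW : Convex ℝ W) (hWc : IsClosed W)
    (hWn : W.Nonempty)
    (h : ∀ᵐ u ∂volume.restrict (Icc s t), ∃ v, HasDerivAt φ v u ∧ v ∈ W) :
    ∃ w ∈ W, φ t - φ s = (t - s) • w := by
  rcases hst.eq_or_lt with rfl | hlt
  · obtain ⟨w, hw⟩ := hWn
    exact ⟨w, hw, by simp⟩
  have hpos : 0 < t - s := sub_pos.2 hlt
  refine ⟨(t - s)⁻¹ • (φ t - φ s), ?_, by rw [smul_smul, mul_inv_cancel₀ hpos.ne', one_smul]⟩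
  by_contra hnot
  -- If the average velocity were outside `W`, a separating functional would grow faster along the
  -- path than its increment allows.
  obtain ⟨f, u, hu, hf⟩ := geometric_hahn_banach_point_closed hW hWc hnot
  have key := mul_sub_le_of_absolutelyContinuous hst
    (absolutelyContinuousOnInterval_clm hφ f) (c := u) (by
      filter_upwards [h] with τ ⟨v, hv, hvW⟩
      exact ⟨f v, f.hasFDerivAt.comp_hasDerivAt τ hv, (hf v hvW).le⟩)
  rw [map_smul, map_sub, smul_eq_mul, inv_mul_lt_iff₀ hpos] at hu
  linarith

/-! ### Convex hulls of a compact convex set and a finite set -/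

theorem isCompact_convexHull_union {K D : Set (E n)} (hK : IsCompact K) (hKc : Convex ℝ K)
    (hD : D.Finite) : IsCompact (convexHull ℝ (K ∪ D)) := by
  rcases K.eq_empty_or_nonempty with rfl | hKn
  · rw [empty_union]; exact hD.isCompact_convexHull ℝ
  rcases D.eq_empty_or_nonempty with rfl | hDn
  · rw [union_empty, hKc.convexHull_eq]; exact hK
  have h : convexHull ℝ (K ∪ D) =
      (fun p : ℝ × E n × E n => (1 - p.1) • p.2.1 + p.1 • p.2.2) ''
        (Icc 0 1 ×ˢ K ×ˢ convexHull ℝ D) := by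
    rw [convexHull_union hKn hDn, hKc.convexHull_eq]
    ext x
    simp only [mem_convexJoin, segment_eq_image, mem_image, mem_prod, Prod.exists]
    constructor
    · rintro ⟨a, ha, b, hb, θ, hθ, rfl⟩
      exact ⟨θ, a, b, ⟨hθ, ha, hb⟩, rfl⟩
    · rintro ⟨θ, a, b, ⟨hθ, ha, hb⟩, rfl⟩
      exact ⟨a, ha, b, hb, θ, hθ, rfl⟩
  rw [h]
  exact (isCompact_Icc.prod (hK.prod (hD.isCompact_convexHull ℝ))).image (by fun_prop)

/-- A point of the hull lies on a segment from `K` to the hull of `D`. The alternative `s = 1 ∧ r =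
0` covers empty `D`, where no reaction is available and `Q` may be empty. -/
theorem exists_decomposition_of_mem_convexHull_union {K D : Set (E n)} (hKc : Convex ℝ K)
    (hKn : K.Nonempty) {Q : Set (E n)} (hQ : Convex ℝ Q) (hDQ : D ⊆ Q) {u : E n}
    (hu : u ∈ convexHull ℝ (K ∪ D)) :
    ∃ s ∈ Icc (0 : ℝ) 1, ∃ β ∈ K, ∃ r, (s = 1 ∧ r = 0 ∨ r ∈ Q) ∧
      u = s • β + (1 - s) • r := by
  rcases D.eq_empty_or_nonempty with rfl | hDn
  · rw [union_empty, hKc.convexHull_eq] at hu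
    exact ⟨1, by simp, u, hu, 0, Or.inl ⟨rfl, rfl⟩, by simp⟩
  rw [convexHull_union hKn hDn, hKc.convexHull_eq, mem_convexJoin] at hu
  obtain ⟨β, hβ, r, hr, hu⟩ := hu
  rw [segment_eq_image] at hu
  obtain ⟨θ, hθ, rfl⟩ := hu
  exact ⟨1 - θ, ⟨by linarith [hθ.2], by linarith [hθ.1]⟩, β, hβ, r,
    Or.inr (convexHull_min hDQ hQ hr), by simp⟩

/-! ### Localization of the smoothed velocities -/

theorem mem_outerSet {nrm : Fin N → E n} {x : E n} {i : Fin N} :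
    i ∈ outerSet nrm x ↔ inner ℝ x (nrm i) ≤ 0 := by
  simp [outerSet]

theorem measurable_outerSet (nrm : Fin N → E n) :
    @Measurable _ _ _ ⊤ (outerSet nrm) := by
  let _ : MeasurableSpace (Finset (Fin N)) := ⊤
  refine measurable_to_countable' fun s => ?_
  have h : outerSet nrm ⁻¹' {s} = ⋂ i, {x | inner ℝ x (nrm i) ≤ 0 ↔ i ∈ s} := by
    ext x
    simp [Finset.ext_iff, mem_outerSet]
  rw [h]
  refine MeasurableSet.iInter fun i => ?_
  have hm : MeasurableSet {x : E n | inner ℝ x (nrm i) ≤ 0} :=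
    (isClosed_le (continuous_id.inner continuous_const) continuous_const).measurableSet
  by_cases hi : i ∈ s
  · simpa [hi] using hm
  · have h2 : {x : E n | inner ℝ x (nrm i) ≤ 0 ↔ i ∈ s} = {x | inner ℝ x (nrm i) ≤ 0}ᶜ := by
      ext x; simp [hi]
    rw [h2]
    exact hm.compl

theorem measurable_vel (nrm : Fin N → E n) (dl : Finset (Fin N) → E n) (β : E n) :
    Measurable (vel nrm dl β) := by
  let _ : MeasurableSpace (Finset (Fin N)) := ⊤
  have h : Measurable fun x => dl (outerSet nrm x) :=
    (measurable_from_top (f := dl)).comp (measurable_outerSet nrm)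
  exact Measurable.ite (isClosed_polyCone nrm).measurableSet measurable_const h

theorem norm_vel_le (nrm : Fin N → E n) (dl : Finset (Fin N) → E n) (β x : E n) :
    ‖vel nrm dl β x‖ ≤ ‖β‖ + ∑ s, ‖dl s‖ := by
  have h0 : 0 ≤ ∑ s, ‖dl s‖ := Finset.sum_nonneg fun _ _ => norm_nonneg _
  unfold vel
  split_ifs
  · linarith
  · have : ‖dl (outerSet nrm x)‖ ≤ ∑ s, ‖dl s‖ := Finset.single_le_sum
      (f := fun s => ‖dl s‖) (fun _ _ => norm_nonneg _) (Finset.mem_univ (outerSet nrm x))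
    linarith [norm_nonneg β]

/-- Substitute `z = (x - y) / (a‖x‖)`; the Jacobian cancels the normalization. -/
theorem velMoll_eq_integral (nrm : Fin N → E n) (dl : Finset (Fin N) → E n) (ρ : E n → ℝ)
    {a : ℝ} (β : E n) {x : E n} (hr : 0 < a * ‖x‖) :
    velMoll nrm dl ρ a β x = ∫ z, ρ z • vel nrm dl β (x - (a * ‖x‖) • z) := by
  set r := a * ‖x‖
  set H : E n → E n := fun z => ρ z • vel nrm dl β (x - r • z) with hH
  have h1 : ∀ y, ρ ((1 / r) • (x - y)) • vel nrm dl β y = H ((1 / r) • (x - y)) := by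
    intro y
    simp only [hH]
    rw [smul_smul, mul_one_div_cancel hr.ne', one_smul, sub_sub_cancel]
  have h2 : ∫ y, H ((1 / r) • (x - y)) = ∫ y, H ((1 / r) • y) :=
    integral_sub_left_eq_self (fun y => H ((1 / r) • y)) volume x
  rw [velMoll]
  change (1 / r ^ n) • ∫ y, ρ ((1 / r) • (x - y)) • vel nrm dl β y = _
  simp only [h1]
  rw [h2, Measure.integral_comp_smul, finrank_euclideanSpace_fin, smul_smul,
    abs_of_pos (by positivity)]
  have : 1 / r ^ n * ((1 / r) ^ n)⁻¹ = 1 := by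
    rw [one_div, one_div, inv_pow, inv_inv, inv_mul_cancel₀ (pow_pos hr n).ne']
  rw [this, one_smul]

/-- A mollification of `v(β, ·)` stays in each closed convex set which contains the nearby values. -/
theorem velMoll_mem {nrm : Fin N → E n} {dl : Finset (Fin N) → E n} {ρ : E n → ℝ}
    (hρ : Continuous ρ) (hρ0 : ∀ x, 0 ≤ ρ x) (hρs : tsupport ρ ⊆ Metric.closedBall 0 1)
    (hρ1 : ∫ x, ρ x = 1) {W : Set (E n)} (hW : Convex ℝ W) (hWc : IsClosed W) {a : ℝ} {β x : E n}
    (hr : 0 < a * ‖x‖) (h : ∀ y, ‖y - x‖ ≤ a * ‖x‖ → vel nrm dl β y ∈ W) :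
    velMoll nrm dl ρ a β x ∈ W := by
  rw [velMoll_eq_integral nrm dl ρ β hr]
  set r := a * ‖x‖
  have hcs : HasCompactSupport ρ :=
    (isCompact_closedBall (0 : E n) 1).of_isClosed_subset (isClosed_tsupport ρ) hρs
  have hint : Integrable ρ := hρ.integrable_of_hasCompactSupport hcs
  have hmeas : Measurable fun z => (ρ z).toNNReal := hρ.measurable.real_toNNReal
  -- With `ρ` as a probability density the mollification is a mean, and means stay in closed convex
  -- sets.
  set ν : Measure (E n) := volume.withDensity fun z => ((ρ z).toNNReal : ENNReal) with hν
  have hprob : IsProbabilityMeasure ν := by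
    constructor
    rw [hν, withDensity_apply _ MeasurableSet.univ, Measure.restrict_univ]
    change ∫⁻ z, ENNReal.ofReal (ρ z) = 1
    rw [← ofReal_integral_eq_lintegral_ofReal hint (Eventually.of_forall hρ0), hρ1,
      ENNReal.ofReal_one]
  have heq : ∫ z, ρ z • vel nrm dl β (x - r • z) = ∫ z, vel nrm dl β (x - r • z) ∂ν := by
    rw [hν, integral_withDensity_eq_integral_smul hmeas]
    refine integral_congr_ae (Eventually.of_forall fun z => ?_)
    simp only [NNReal.smul_def, Real.coe_toNNReal _ (hρ0 z)]
  rw [heq]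
  refine hW.integral_mem hWc ?_ ?_
  · rw [hν, ae_withDensity_iff hmeas.coe_nnreal_ennreal]
    refine Eventually.of_forall fun z hz => h _ ?_
    have hz0 : ρ z ≠ 0 := fun h0 => hz (by simp [h0])
    have hz1 : ‖z‖ ≤ 1 := by simpa using hρs (subset_tsupport ρ hz0)
    rw [sub_sub_cancel_left, norm_neg, norm_smul, Real.norm_of_nonneg hr.le]
    exact mul_le_of_le_one_right hr.le hz1
  · refine Integrable.of_bound ?_ (‖β‖ + ∑ s, ‖dl s‖)
      (Eventually.of_forall fun z => norm_vel_le nrm dl β _)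
    exact ((measurable_vel nrm dl β).comp (by fun_prop)).aestronglyMeasurable

theorem inner_eq_zero_of_mem_face {nrm : Fin N → E n} {i : Fin N} {z : E n}
    (hz : z ∈ face nrm i) : inner ℝ z (nrm i) = 0 :=
  (frontier_le_subset_eq continuous_const (continuous_id.inner continuous_const) hz.2).symm

theorem face_subset_polyCone (nrm : Fin N → E n) (i : Fin N) : face nrm i ⊆ polyCone nrm :=
  inter_subset_left.trans (isClosed_polyCone nrm).frontier_subset

theorem zero_mem_polyCone (nrm : Fin N → E n) : (0 : E n) ∈ polyCone nrm :=
  mem_polyCone.2 fun i => by simp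

theorem zero_mem_face {nrm : Fin N → E n} (hnrm : ∀ i, ‖nrm i‖ = 1) (i : Fin N) :
    (0 : E n) ∈ face nrm i := by
  have hi0 : nrm i ≠ 0 := fun h0 => by simpa [h0] using hnrm i
  have h1 : polyCone (fun _ : Fin 1 => nrm i) = halfSpace (nrm i) := iInter_const _
  refine ⟨mem_frontier_polyCone hi0 (zero_mem_polyCone nrm) (inner_zero_left _), ?_⟩
  rw [← h1]
  exact mem_frontier_polyCone (i := 0) hi0 (zero_mem_polyCone _) (inner_zero_left _)

/-- Abstract localization: `K^a(β, x)` is contained in every closed convex set containing the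
velocities which are switched on near `x`. -/
theorem velHull_subset {nrm d : Fin N → E n} {dl : Finset (Fin N) → E n}
    (hnrm : ∀ i, ‖nrm i‖ = 1) {ρ : E n → ℝ}
    (hρ : Continuous ρ) (hρ0 : ∀ x, 0 ≤ ρ x) (hρs : tsupport ρ ⊆ Metric.closedBall 0 1)
    (hρ1 : ∫ x, ρ x = 1) {g : ℝ → ℝ} (hg01 : ∀ z, g z ∈ Icc (0 : ℝ) 1)
    (hg0 : ∀ z, 1 ≤ z → g z = 0) {W : Set (E n)} (hW : Convex ℝ W) (hWc : IsClosed W)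
    {a : ℝ} {β x : E n} (ha : 0 < a) (hx : x ≠ 0)
    (hvel : ∀ y, ‖y - x‖ ≤ a * ‖x‖ → vel nrm dl β y ∈ W)
    (hface : ∀ i, ∀ z ∈ face nrm i, ‖z - x‖ < a * ‖x‖ → d i ∈ W)
    (hcone : ∀ z ∈ polyCone nrm, ‖z - x‖ < a * ‖x‖ → β ∈ W) :
    velHull nrm d dl ρ g a β x ⊆ W := by
  have hr : 0 < a * ‖x‖ := mul_pos ha (norm_pos_iff.2 hx)
  have hM := velMoll_mem hρ hρ0 hρs hρ1 hW hWc hr hvel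
  -- A nonzero cut-off forces a point of `S` within `a * ‖x‖` of `x`; otherwise only the mollified
  -- velocity remains.
  have key : ∀ (S : Set (E n)) (v : E n), S.Nonempty →
      (∀ z ∈ S, ‖z - x‖ < a * ‖x‖ → v ∈ W) →
      g (Metric.infDist x S / (a * ‖x‖)) • v +
        (1 - g (Metric.infDist x S / (a * ‖x‖))) • velMoll nrm dl ρ a β x ∈ W := by
    intro S v hS hv
    rcases lt_or_ge (Metric.infDist x S) (a * ‖x‖) with hlt | hge
    · obtain ⟨z, hz, hzx⟩ := (Metric.infDist_lt_iff hS).1 hlt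
      rw [dist_comm, dist_eq_norm] at hzx
      obtain ⟨h0, h1⟩ := hg01 (Metric.infDist x S / (a * ‖x‖))
      exact hW (hv z hz hzx) hM h0 (by linarith) (by ring)
    · rw [hg0 _ ((one_le_div hr).2 hge)]
      simpa using hM
  refine convexHull_min (insert_subset ?_ (range_subset_iff.2 fun i => ?_)) hW
  · rw [velZero, if_neg hx]
    exact key _ _ ⟨0, zero_mem_polyCone nrm⟩ hcone
  · rw [velFace, if_neg hx]
    exact key _ _ ⟨0, zero_mem_face hnrm i⟩ (hface i)

theorem velSet_zero_subset {nrm d : Fin N → E n} {dl : Finset (Fin N) → E n} {ρ : E n → ℝ}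
    {g : ℝ → ℝ} {C₁ : Set (E n)} {a : ℝ} : velSet nrm d dl ρ g C₁ a 0 ⊆ {0} := by
  refine iUnion₂_subset fun β _ => convexHull_min (insert_subset ?_ (range_subset_iff.2 ?_))
    (convex_singleton 0)
  · simp [velZero]
  · simp [velFace]

/-- The velocities available where (at most) the constraints in `I` are active. -/
def localGen (d : Fin N → E n) (dl : Finset (Fin N) → E n) (I : Finset (Fin N)) : Set (E n) :=
  d '' I ∪ dl '' {s | s.Nonempty ∧ s ⊆ I}

theorem localGen_finite (d : Fin N → E n) (dl : Finset (Fin N) → E n) (I : Finset (Fin N)) :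
    (localGen d dl I).Finite :=
  (I.finite_toSet.image d).union ((toFinite _).image dl)

theorem abs_inner_sub_le {ν x y : E n} (hν : ‖ν‖ = 1) :
    |inner ℝ y ν - inner ℝ x ν| ≤ ‖y - x‖ := by
  rw [← inner_sub_left]
  simpa [hν] using abs_real_inner_le_norm (y - x) ν

/-- A constraint that is violated or active at a point within `a * ‖x‖` of `x` is nearly active at
`x`, since inner products with unit normals are 1-Lipschitz. Enlarging `C₁` to a convex `K` gives
one convex set valid for all `β`, so that velocities can be averaged in time. -/
theorem velSet_subset_convexHull {nrm d : Fin N → E n} {dl : Finset (Fin N) → E n}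
    (hnrm : ∀ i, ‖nrm i‖ = 1) {ρ : E n → ℝ}
    (hρ : Continuous ρ) (hρ0 : ∀ x, 0 ≤ ρ x) (hρs : tsupport ρ ⊆ Metric.closedBall 0 1)
    (hρ1 : ∫ x, ρ x = 1) {g : ℝ → ℝ} (hg01 : ∀ z, g z ∈ Icc (0 : ℝ) 1)
    (hg0 : ∀ z, 1 ≤ z → g z = 0) {C₁ K : Set (E n)} (hK : IsCompact K) (hKc : Convex ℝ K)
    (hCK : C₁ ⊆ K) {a : ℝ} (ha : 0 < a) {x : E n} (hx : x ≠ 0) {I : Finset (Fin N)}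
    (hI : ∀ i, inner ℝ x (nrm i) ≤ a * ‖x‖ → i ∈ I) :
    velSet nrm d dl ρ g C₁ a x ⊆ convexHull ℝ (K ∪ localGen d dl I) := by
  refine iUnion₂_subset fun β hβ => velHull_subset hnrm hρ hρ0 hρs hρ1 hg01 hg0
    (convex_convexHull ℝ _)
    (isCompact_convexHull_union hK hKc (localGen_finite d dl I)).isClosed ha hx ?_ ?_ ?_
  · intro y hy
    refine subset_convexHull ℝ _ ?_
    unfold vel
    split_ifs with hG
    · exact Or.inl (hCK hβ)
    · refine Or.inr (Or.inr ⟨_, ⟨?_, fun i hi => hI i ?_⟩, rfl⟩)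
      · rw [mem_polyCone] at hG
        push Not at hG
        obtain ⟨i, hi⟩ := hG
        exact ⟨i, mem_outerSet.2 hi.le⟩
      · have h1 := (abs_le.1 (abs_inner_sub_le (hnrm i) (x := x) (y := y))).1
        have h2 := mem_outerSet.1 hi
        linarith
  · intro i z hz hzx
    refine subset_convexHull ℝ _ (Or.inr (Or.inl ⟨i, hI i ?_, rfl⟩))
    have h1 := (abs_le.1 (abs_inner_sub_le (hnrm i) (x := x) (y := z))).1
    rw [inner_eq_zero_of_mem_face hz] at h1
    linarith
  · exact fun _ _ _ => subset_convexHull ℝ _ (Or.inl (hCK hβ))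

/-- Outside a neighbourhood of `G` the velocities push towards `G`. -/
theorem le_inner_of_mem_velSet {nrm d : Fin N → E n} {dl : Finset (Fin N) → E n}
    (hnrm : ∀ i, ‖nrm i‖ = 1) {ρ : E n → ℝ}
    (hρ : Continuous ρ) (hρ0 : ∀ x, 0 ≤ ρ x) (hρs : tsupport ρ ⊆ Metric.closedBall 0 1)
    (hρ1 : ∫ x, ρ x = 1) {g : ℝ → ℝ} (hg01 : ∀ z, g z ∈ Icc (0 : ℝ) 1)
    (hg0 : ∀ z, 1 ≤ z → g z = 0) {C₁ : Set (E n)} {c : ℝ}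
    (hc : ∀ s : Finset (Fin N), ∀ i ∈ s, c ≤ inner ℝ (dl s) (nrm i)) {a : ℝ} (ha : 0 < a)
    {x u : E n} {i : Fin N} (hi : inner ℝ x (nrm i) < -(a * ‖x‖))
    (hu : u ∈ velSet nrm d dl ρ g C₁ a x) : c ≤ inner ℝ u (nrm i) := by
  have hx : x ≠ 0 := by rintro rfl; simp at hi
  -- The ball of radius `a * ‖x‖` misses the half space, so `β` and all `d j` are switched off; only
  -- `dl s` with `i ∈ s` enter.
  have hout : ∀ y, ‖y - x‖ ≤ a * ‖x‖ → inner ℝ y (nrm i) < 0 := fun y hy => by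
    have := (abs_le.1 (abs_inner_sub_le (hnrm i) (x := x) (y := y))).2
    linarith
  have hlin : IsLinearMap ℝ fun v : E n => inner ℝ v (nrm i) :=
    ⟨fun _ _ => inner_add_left _ _ _, fun _ _ => real_inner_smul_left _ _ _⟩
  obtain ⟨β, -, hu⟩ := mem_iUnion₂.1 hu
  refine velHull_subset hnrm hρ hρ0 hρs hρ1 hg01 hg0 (W := {v | c ≤ inner ℝ v (nrm i)})
    (convex_halfSpace_ge hlin c)
    (isClosed_le continuous_const (continuous_id.inner continuous_const)) ha hx ?_ ?_ ?_ hu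
  · intro y hy
    have hy0 := hout y hy
    have : y ∉ polyCone nrm := fun hG => (mem_polyCone.1 hG i).not_gt hy0
    rw [mem_ofPred_eq, vel, if_neg this]
    exact hc _ i (mem_outerSet.2 hy0.le)
  · exact fun j z hz hzx =>
      absurd (hout z hzx.le) (mem_polyCone.1 (face_subset_polyCone nrm j hz) i).not_gt
  · exact fun z hz hzx => absurd (hout z hzx.le) (mem_polyCone.1 hz i).not_gt

/-! ### Paths close to the cone -/

/-- A set `K` of drifts well inside the stability cone, with the constants governing paths which
are driven by `K` and by the reaction directions. -/
structure DriftData (nrm d : Fin N → E n) where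
  /-- the drifts -/
  K : Set (E n)
  /-- a functional which is positive on the reaction directions -/
  f : E n →L[ℝ] ℝ
  /-- a lower bound for `f` on reactions -/
  c : ℝ
  /-- the distance of the drifts from the boundary of the stability cone -/
  δ : ℝ
  /-- a bound for all velocities -/
  B : ℝ
  /-- a Lipschitz constant of the Skorohod map -/
  ℓ : ℝ
  /-- the relative width of the boundary layer -/
  κ : ℝ
  c_pos : 0 < c
  δ_pos : 0 < δ
  B_nonneg : 0 ≤ B
  one_le_ℓ : 1 ≤ ℓ
  κ_pos : 0 < κ
  norm_le : ∀ β ∈ K, ‖β‖ ≤ B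
  add_mem : ∀ β ∈ K, ∀ w, ‖w‖ ≤ δ → β + w ∈ stabilityCone d
  discrete_bound : ∀ (X h h' : ℕ → E n) (D : ℝ), (∀ k, X k ∈ polyCone nrm) →
      (∀ k, h k ∈ coneGen d (activeSet nrm (X (k + 1)))) →
      (∀ k, h' k ∈ coneGen d Finset.univ) →
      (∀ k, ‖X k - ∑ j ∈ Finset.range k, (h j - h' j)‖ ≤ D) → ∀ k, ‖X k‖ ≤ ℓ * D
  face_approx : ∀ (I : Finset (Fin N)) (x : E n),
      (∀ i, -(κ * ‖x‖) ≤ inner ℝ x (nrm i)) → (∀ i ∈ I, inner ℝ x (nrm i) ≤ κ * ‖x‖) →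
      ∃ p ∈ polyCone nrm, I ⊆ activeSet nrm p ∧ ‖p - x‖ ≤ (4 * ℓ)⁻¹ * ‖x‖

/-- From time `s₀` on, `φ` stays near the cone and its increments are combinations of drifts and of
reactions along constraints which are nearly active. -/
structure ControlledFrom {nrm d : Fin N → E n} (P : DriftData nrm d) (φ : ℝ → E n) (s₀ : ℝ) :
    Prop where
  lip : ∀ s t, s₀ ≤ s → s ≤ t → ‖φ t - φ s‖ ≤ P.B * (t - s)
  near : ∀ u, s₀ ≤ u → ∀ i, -(P.κ * ‖φ u‖) ≤ inner ℝ (φ u) (nrm i)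
  incr : ∀ s t (I : Finset (Fin N)), s₀ ≤ s → s ≤ t →
    (∀ u ∈ Icc s t, φ u ≠ 0 ∧ ∀ i, inner ℝ (φ u) (nrm i) ≤ P.κ / 2 * ‖φ u‖ → i ∈ I) →
    ∃ σ ∈ Icc (0 : ℝ) 1, ∃ β ∈ P.K, ∃ r ∈ coneGen d I,
      φ t - φ s = (t - s) • (σ • β + r) ∧ (1 - σ) * P.c ≤ P.f r

namespace ControlledFrom

variable {nrm d : Fin N → E n} {P : DriftData nrm d} {φ : ℝ → E n} {s₀ : ℝ}

theorem mono (h : ControlledFrom P φ s₀) {s : ℝ} (hs : s₀ ≤ s) : ControlledFrom P φ s :=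
  ⟨fun _ _ h1 => h.lip _ _ (hs.trans h1), fun _ h1 => h.near _ (hs.trans h1),
    fun _ _ _ h1 => h.incr _ _ _ (hs.trans h1)⟩

theorem continuousOn (h : ControlledFrom P φ s₀) : ContinuousOn φ (Ici s₀) := by
  refine LipschitzOnWith.continuousOn (K := P.B.toNNReal) (LipschitzOnWith.of_dist_le_mul ?_)
  intro x hx y hy
  rw [Real.coe_toNNReal _ P.B_nonneg, dist_eq_norm, Real.dist_eq]
  rcases le_total x y with hxy | hxy
  · rw [norm_sub_rev, abs_sub_comm, abs_of_nonneg (sub_nonneg.2 hxy)]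
    exact h.lip _ _ hx hxy
  · rw [abs_of_nonneg (sub_nonneg.2 hxy)]
    exact h.lip _ _ hy hxy

/-- Comparison with the solution resting at the vertex, after weighting the path with a factor
growing with the amount `A` of drift used. -/
theorem weighted_bound (hnrm : ∀ i, ‖nrm i‖ = 1) (h : ControlledFrom P φ s₀) {t ν : ℝ}
    (hst : s₀ ≤ t) (hne : ∀ u ∈ Icc s₀ t, φ u ≠ 0) (hν : 0 ≤ ν)
    (hνφ : ∀ u ∈ Icc s₀ t, ν * ‖φ u‖ ≤ 1) :
    ∃ A : ℝ, 0 ≤ A ∧ (1 + ν * P.δ * A) * ‖φ t‖ ≤ 2 * P.ℓ * ‖φ s₀‖ ∧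
      P.c * (t - s₀) ≤ (P.c + ‖P.f‖ * P.B) * A + ‖P.f‖ * (‖φ t‖ + ‖φ s₀‖) := by
  have hB := P.B_nonneg
  have hκ := P.κ_pos
  have hℓ := P.one_le_ℓ
  have hδ := P.δ_pos
  have hc := P.c_pos
  have hcont : ContinuousOn φ (Icc s₀ t) := h.continuousOn.mono Icc_subset_Ici_self
  obtain ⟨u₀, hu₀, hmin⟩ := isCompact_Icc.exists_isMinOn (nonempty_Icc.2 hst) hcont.norm
  obtain ⟨M, hM⟩ := isCompact_Icc.exists_bound_of_continuousOn hcont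
  set m := ‖φ u₀‖
  have hm : 0 < m := norm_pos_iff.2 (hne u₀ hu₀)
  have hmle : ∀ u ∈ Icc s₀ t, m ≤ ‖φ u‖ := fun u hu => hmin hu
  -- The mesh is small relative to the minimal norm `m`, so that a constraint `κ/2`-active anywhere
  -- in a time step is `κ`-active at its right endpoint. This is where nonvanishing of `φ` matters.
  set τ := P.κ * m / ((P.κ + 2) * (P.B + 1)) with hτdef
  have hτ : 0 < τ := by positivity
  have hτm : (P.κ / 2 + 1) * (P.B * τ) ≤ P.κ / 2 * m := by
    have h1 : τ * ((P.κ + 2) * (P.B + 1)) = P.κ * m := by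
      rw [hτdef]; field_simp
    have h2 : 0 ≤ τ * (P.κ + 2) := by positivity
    nlinarith
  -- Truncation at `t` makes the infinite sequence of sampling times eventually constant.
  set T : ℕ → ℝ := fun k => min (s₀ + k * τ) t with hT
  have hT0 : T 0 = s₀ := by simp [hT, hst]
  have hTmono : ∀ k, T k ≤ T (k + 1) := by
    intro k
    simp only [hT]
    push_cast
    exact min_le_min_right _ (by linarith)
  have hTstep : ∀ k, T (k + 1) - T k ≤ τ := by
    intro k
    simp only [hT]
    push_cast
    rcases le_total (s₀ + k * τ) t with h1 | h1
    · rw [min_eq_left h1]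
      linarith [min_le_left (s₀ + (k + 1) * τ) t]
    · rw [min_eq_right h1]
      linarith [min_le_right (s₀ + (k + 1) * τ) t]
  have hTs : ∀ k, s₀ ≤ T k := fun k => le_min (by have : 0 ≤ k * τ := by positivity
                                                  linarith) hst
  have hTt : ∀ k, T k ≤ t := fun k => min_le_right _ _
  have hTmem : ∀ k, T k ∈ Icc s₀ t := fun k => ⟨hTs k, hTt k⟩
  obtain ⟨k₁, hk₁⟩ : ∃ k : ℕ, T k = t := by
    obtain ⟨k, hk⟩ := exists_nat_ge ((t - s₀) / τ)
    rw [div_le_iff₀ hτ] at hk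
    exact ⟨k, min_eq_right (by linarith)⟩
  set J : ℕ → Finset (Fin N) := fun k =>
    Finset.univ.filter fun i => inner ℝ (φ (T k)) (nrm i) ≤ P.κ * ‖φ (T k)‖ with hJ
  have hincr : ∀ k, ∃ σ ∈ Icc (0 : ℝ) 1, ∃ β ∈ P.K, ∃ r ∈ coneGen d (J (k + 1)),
      φ (T (k + 1)) - φ (T k) = (T (k + 1) - T k) • (σ • β + r) ∧ (1 - σ) * P.c ≤ P.f r := by
    intro k
    refine h.incr _ _ _ (hTs k) (hTmono k) fun u hu => ?_
    have hu' : u ∈ Icc s₀ t := ⟨(hTs k).trans hu.1, hu.2.trans (hTt _)⟩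
    refine ⟨hne u hu', fun i hi => ?_⟩
    simp only [hJ, Finset.mem_filter, Finset.mem_univ, true_and]
    have h1 : ‖φ (T (k + 1)) - φ u‖ ≤ P.B * τ :=
      (h.lip _ _ hu'.1 hu.2).trans (by
        gcongr
        linarith [hTstep k, hu.1])
    have h2 := (abs_le.1 (abs_inner_sub_le (hnrm i) (x := φ u) (y := φ (T (k + 1))))).2
    have h3 : ‖φ u‖ ≤ ‖φ (T (k + 1))‖ + P.B * τ := by
      have := norm_sub_norm_le (φ u) (φ (T (k + 1)))
      rw [norm_sub_rev] at this
      linarith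
    have h4 := hmle _ (hTmem (k + 1))
    have h5 : P.κ / 2 * ‖φ u‖ ≤ P.κ / 2 * (‖φ (T (k + 1))‖ + P.B * τ) := by gcongr
    have h6 : P.κ / 2 * m ≤ P.κ / 2 * ‖φ (T (k + 1))‖ := by gcongr
    linarith
  choose σ hσ β hβ r hr hφ hfr using hincr
  have happ : ∀ k, ∃ p ∈ polyCone nrm, J k ⊆ activeSet nrm p ∧
      ‖p - φ (T k)‖ ≤ (4 * P.ℓ)⁻¹ * ‖φ (T k)‖ := fun k =>
    P.face_approx _ _ (h.near _ (hTs k)) fun i hi => (Finset.mem_filter.1 hi).2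
  choose p hpG hpJ hpφ using happ
  set Δ : ℕ → ℝ := fun k => T (k + 1) - T k with hΔ
  have hΔ0 : ∀ k, 0 ≤ Δ k := fun k => sub_nonneg.2 (hTmono k)
  have hΔσ : ∀ k, 0 ≤ Δ k * σ k := fun k => mul_nonneg (hΔ0 k) (hσ k).1
  set A : ℕ → ℝ := fun k => ∑ j ∈ Finset.range k, Δ j * σ j with hA
  have hA0 : ∀ k, 0 ≤ A k := fun k => Finset.sum_nonneg fun j _ => hΔσ j
  have hAle : ∀ k, A k ≤ t - s₀ := by
    intro k
    calc A k ≤ ∑ j ∈ Finset.range k, Δ j :=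
          Finset.sum_le_sum fun j _ => mul_le_of_le_one_right (hΔ0 j) (hσ j).2
      _ = T k - T 0 := Finset.sum_range_sub T k
      _ ≤ t - s₀ := by rw [hT0]; linarith [hTt k]
  have hνδ : 0 ≤ ν * P.δ := mul_nonneg hν hδ.le
  set w : ℕ → ℝ := fun k => 1 + ν * P.δ * A k with hw
  have hw1 : ∀ k, 1 ≤ w k := fun k => by
    have := mul_nonneg hνδ (hA0 k)
    simp only [hw]
    linarith
  have hwpos : ∀ k, 0 < w k := fun k => one_pos.trans_le (hw1 k)
  have hw0 : w 0 = 1 := by simp [hw, hA]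
  have hwsucc : ∀ k, w (k + 1) - w k = ν * P.δ * (Δ k * σ k) := fun k => by
    simp only [hw, hA, Finset.sum_range_succ]
    ring
  have hbdd : BddAbove (range fun k => w k * ‖φ (T k)‖) := by
    refine ⟨(1 + ν * P.δ * (t - s₀)) * M, ?_⟩
    rintro _ ⟨k, rfl⟩
    have h1 : w k ≤ 1 + ν * P.δ * (t - s₀) := by
      simp only [hw]
      gcongr
      exact hAle k
    exact mul_le_mul h1 (hM _ (hTmem k)) (norm_nonneg _) ((hwpos k).le.trans h1)
  -- The projection error is at most `ε * Q`; since `ℓ * ε = 1/4` it can be absorbed into the left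
  -- side of the Lipschitz estimate for `Q`.
  set Q := ⨆ k, w k * ‖φ (T k)‖ with hQ
  have hleQ : ∀ k, w k * ‖φ (T k)‖ ≤ Q := fun k => le_ciSup hbdd k
  have hQ0 : 0 ≤ Q := (mul_nonneg (hwpos 0).le (norm_nonneg _)).trans (hleQ 0)
  set ε := (4 * P.ℓ)⁻¹ with hε
  have hε0 : 0 ≤ ε := by positivity
  have hεℓ : P.ℓ * ε = 1 / 4 := by rw [hε]; field_simp
  have hε4 : ε ≤ 1 / 4 := by
    rw [← hεℓ]
    exact le_mul_of_one_le_left hε0 hℓ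
  have hpw : ∀ k, ‖w k • (p k - φ (T k))‖ ≤ ε * Q := fun k => by
    rw [norm_smul, Real.norm_of_nonneg (hwpos k).le]
    calc w k * ‖p k - φ (T k)‖ ≤ w k * (ε * ‖φ (T k)‖) :=
          mul_le_mul_of_nonneg_left (hpφ k) (hwpos k).le
      _ = ε * (w k * ‖φ (T k)‖) := by ring
      _ ≤ ε * Q := mul_le_mul_of_nonneg_left (hleQ k) hε0
  -- The reaction at rest cancels both the drift and the increment due to the changing weight. Then
  -- `h - h'` telescopes to the increments of `w k • φ (T k)`, leaving only the projection error and
  -- the initial point.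
  have key := P.discrete_bound (fun k => w k • p k) (fun k => (w (k + 1) * Δ k) • r k)
    (fun k => -((w (k + 1) * Δ k) • (σ k • β k) + (w (k + 1) - w k) • φ (T k)))
    (ε * Q + ‖φ s₀‖) ?_ ?_ ?_ ?_
  · have hQle : Q ≤ 2 * P.ℓ * ‖φ s₀‖ := by
      have h1 : Q ≤ P.ℓ * (ε * Q + ‖φ s₀‖) + ε * Q := by
        refine ciSup_le fun k => ?_
        have h2 : w k * ‖φ (T k)‖ = ‖w k • p k - w k • (p k - φ (T k))‖ := by
          rw [smul_sub, sub_sub_cancel, norm_smul, Real.norm_of_nonneg (hwpos k).le]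
        rw [h2]
        exact (norm_sub_le _ _).trans (add_le_add (key k) (hpw k))
      have h3 : ε * Q ≤ 1 / 4 * Q := mul_le_mul_of_nonneg_right hε4 hQ0
      have h4 : P.ℓ * (ε * Q + ‖φ s₀‖) = 1 / 4 * Q + P.ℓ * ‖φ s₀‖ := by
        rw [mul_add, ← mul_assoc, hεℓ]
      linarith
    refine ⟨A k₁, hA0 _, ?_, ?_⟩
    · have := hleQ k₁
      rw [hk₁] at this
      exact this.trans hQle
    -- Reactions raise `f` by at least `c` per unit of their share `1 - σ`, while drift lowers it by
    -- at most `‖f‖ * B`; summing bounds `A` from below.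
    · have hstep : ∀ j, P.c * Δ j ≤ (P.c + ‖P.f‖ * P.B) * (Δ j * σ j) +
          (P.f (φ (T (j + 1))) - P.f (φ (T j))) := by
        intro j
        have h1 : P.f (φ (T (j + 1))) - P.f (φ (T j)) =
            Δ j * (σ j * P.f (β j) + P.f (r j)) := by
          rw [← map_sub, hφ j, map_smul, map_add, map_smul, smul_eq_mul, smul_eq_mul]
        have h2 : -(‖P.f‖ * P.B) ≤ P.f (β j) := by
          have h3 := (abs_le.1 (P.f.le_opNorm (β j))).1
          have h4 : ‖P.f‖ * ‖β j‖ ≤ ‖P.f‖ * P.B := by gcongr; exact P.norm_le _ (hβ j)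
          linarith
        have h5 : (Δ j * σ j) * -(‖P.f‖ * P.B) ≤ (Δ j * σ j) * P.f (β j) :=
          mul_le_mul_of_nonneg_left h2 (hΔσ j)
        have h6 : Δ j * ((1 - σ j) * P.c) ≤ Δ j * P.f (r j) :=
          mul_le_mul_of_nonneg_left (hfr j) (hΔ0 j)
        rw [h1]
        linarith
      have hsum := Finset.sum_le_sum fun j (_ : j ∈ Finset.range k₁) => hstep j
      rw [← Finset.mul_sum, Finset.sum_add_distrib, ← Finset.mul_sum,
        Finset.sum_range_sub (fun j => P.f (φ (T j))), Finset.sum_range_sub T, hT0, hk₁] at hsum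
      have h1 := (abs_le.1 (P.f.le_opNorm (φ t))).2
      have h2 := (abs_le.1 (P.f.le_opNorm (φ s₀))).1
      have h3 : A k₁ = ∑ j ∈ Finset.range k₁, Δ j * σ j := rfl
      rw [h3]
      linarith
  · intro k
    rw [mem_polyCone]
    intro i
    rw [real_inner_smul_left]
    exact mul_nonneg (hwpos k).le (mem_polyCone.1 (hpG k) i)
  · intro k
    refine smul_mem_coneGen (mul_nonneg (hwpos _).le (hΔ0 k))
      (coneGen_mono (fun i hi => ?_) (hr k))
    rw [mem_activeSet, real_inner_smul_left, mem_activeSet.1 (hpJ (k + 1) hi), mul_zero]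
  · intro k
    rw [← neg_mem_stabilityCone, neg_neg]
    -- The weight changes only while drift acts, so its contribution is a perturbation of `β k`, of
    -- norm at most `δ` because `ν * ‖φ‖ ≤ 1 ≤ w`.
    have h1 : (w (k + 1) * Δ k) • (σ k • β k) + (w (k + 1) - w k) • φ (T k) =
        (w (k + 1) * (Δ k * σ k)) • (β k + (ν * P.δ / w (k + 1)) • φ (T k)) := by
      have h2 : w (k + 1) * (Δ k * σ k) * (ν * P.δ / w (k + 1)) = ν * P.δ * (Δ k * σ k) := by
        have := (hwpos (k + 1)).ne'
        field_simp
      rw [hwsucc, smul_add, smul_smul, smul_smul, h2, mul_assoc]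
    rw [h1]
    refine smul_mem_coneGen (mul_nonneg (hwpos _).le (hΔσ k)) (P.add_mem _ (hβ k) _ ?_)
    rw [norm_smul, Real.norm_of_nonneg (div_nonneg hνδ (hwpos _).le), div_mul_eq_mul_div,
      div_le_iff₀ (hwpos _)]
    have h3 : P.δ * (ν * ‖φ (T k)‖) ≤ P.δ * 1 := by gcongr; exact hνφ _ (hTmem k)
    have h4 : P.δ * 1 ≤ P.δ * w (k + 1) := by gcongr; exact hw1 _
    linarith
  · intro k
    have h1 : ∀ j, (w (j + 1) * Δ j) • r j -
        -((w (j + 1) * Δ j) • (σ j • β j) + (w (j + 1) - w j) • φ (T j)) =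
        w (j + 1) • φ (T (j + 1)) - w j • φ (T j) := by
      intro j
      have h2 : φ (T (j + 1)) = φ (T j) + Δ j • (σ j • β j + r j) := by
        rw [← hφ j]; abel
      rw [h2]
      module
    simp only [h1]
    rw [Finset.sum_range_sub (fun j => w j • φ (T j)), hT0, hw0, one_smul]
    have h3 : w k • p k - (w k • φ (T k) - φ s₀) = w k • (p k - φ (T k)) + φ s₀ := by
      rw [smul_sub]; abel
    rw [h3]
    exact (norm_add_le _ _).trans (add_le_add (hpw k) le_rfl)

/-- Restart just after the last zero `z` before `t`. The constant-weight bound does not depend on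
the mesh, so it gives `‖φ t‖ ≤ 2ℓ‖φ (z + e)‖`, which is too small for small `e`. -/
theorem eq_zero_of_eq_zero (hnrm : ∀ i, ‖nrm i‖ = 1) (h : ControlledFrom P φ s₀) {s t : ℝ}
    (hs : s₀ ≤ s) (hst : s ≤ t) (h0 : φ s = 0) : φ t = 0 := by
  by_contra hne
  have hℓ := P.one_le_ℓ
  have hB := P.B_nonneg
  have hcont : ContinuousOn φ (Icc s t) :=
    h.continuousOn.mono fun u hu => hs.trans hu.1
  have hcl : IsCompact (Icc s t ∩ φ ⁻¹' {0}) :=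
    isCompact_Icc.of_isClosed_subset
      (hcont.preimage_isClosed_of_isClosed isClosed_Icc isClosed_singleton) inter_subset_left
  obtain ⟨z, ⟨hz, hz0⟩, hzmax⟩ := hcl.exists_isGreatest ⟨s, ⟨le_rfl, hst⟩, h0⟩
  have hz0 : φ z = 0 := hz0
  have hzt : z < t := lt_of_le_of_ne hz.2 (by rintro rfl; exact hne hz0)
  have hpos : 0 < ‖φ t‖ := norm_pos_iff.2 hne
  set e := min (t - z) (‖φ t‖ / (2 * (2 * P.ℓ * P.B + 1))) with he
  have he0 : 0 < e := lt_min (sub_pos.2 hzt) (by positivity)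
  have het : z + e ≤ t := by linarith [min_le_left (t - z) (‖φ t‖ / (2 * (2 * P.ℓ * P.B + 1)))]
  have hsz : s₀ ≤ z := hs.trans hz.1
  obtain ⟨A, hA, hle, -⟩ := (h.mono (s := z + e) (by linarith)).weighted_bound hnrm het
    (ν := 0) (fun u hu hu0 => by
      have := hzmax ⟨⟨by linarith [hz.1, hu.1], hu.2⟩, hu0⟩
      linarith [hu.1]) le_rfl (by simp)
  have h1 := h.lip z (z + e) hsz (by linarith)
  rw [hz0, sub_zero, add_sub_cancel_left] at h1
  have h2 : e * (2 * (2 * P.ℓ * P.B + 1)) ≤ ‖φ t‖ := by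
    rw [← le_div_iff₀ (by positivity)]
    exact min_le_right _ _
  have h3 : 2 * P.ℓ * ‖φ (z + e)‖ ≤ 2 * P.ℓ * (P.B * e) := by gcongr
  have h4 : 0 ≤ P.ℓ * P.B * e := by positivity
  simp only [zero_mul, add_zero, one_mul] at hle
  linarith

theorem norm_le (hnrm : ∀ i, ‖nrm i‖ = 1) (h : ControlledFrom P φ s₀) {t : ℝ} (hst : s₀ ≤ t) :
    ‖φ t‖ ≤ 2 * P.ℓ * ‖φ s₀‖ := by
  have hℓ := P.one_le_ℓ
  by_cases hz : ∃ u ∈ Icc s₀ t, φ u = 0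
  · obtain ⟨u, hu, hu0⟩ := hz
    rw [h.eq_zero_of_eq_zero hnrm hu.1 hu.2 hu0, norm_zero]
    positivity
  · push Not at hz
    obtain ⟨A, hA, hle, -⟩ := h.weighted_bound hnrm hst (ν := 0) hz le_rfl (by simp)
    simpa using hle

/-- The a priori bound permits `ν = (2ℓ‖φ s₀‖)⁻¹`. The elapsed time forces `A ≥ 8ℓ²‖φ s₀‖ / δ`, so
the weight exceeds `4ℓ` and beats the factor `2ℓ` by two. -/
theorem norm_le_half (hnrm : ∀ i, ‖nrm i‖ = 1) (h : ControlledFrom P φ s₀) {t : ℝ}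
    (hst : s₀ ≤ t)
    (ht : ((P.c + ‖P.f‖ * P.B) * (8 * P.ℓ ^ 2 / P.δ) + ‖P.f‖ * (2 * P.ℓ + 1)) * ‖φ s₀‖ ≤
      P.c * (t - s₀)) :
    ‖φ t‖ ≤ ‖φ s₀‖ / 2 := by
  have hB := P.B_nonneg
  have hℓ := P.one_le_ℓ
  have hδ := P.δ_pos
  have hc := P.c_pos
  by_cases hz : ∃ u ∈ Icc s₀ t, φ u = 0
  · obtain ⟨u, hu, hu0⟩ := hz
    rw [h.eq_zero_of_eq_zero hnrm hu.1 hu.2 hu0, norm_zero]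
    positivity
  push Not at hz
  have hm : 0 < ‖φ s₀‖ := norm_pos_iff.2 (hz s₀ ⟨le_rfl, hst⟩)
  obtain ⟨A, hA, hle, htime⟩ := h.weighted_bound hnrm hst (ν := (2 * P.ℓ * ‖φ s₀‖)⁻¹) hz
    (by positivity) fun u hu => by
      rw [inv_mul_le_iff₀ (by positivity), mul_one]
      exact h.norm_le hnrm hu.1
  have h1 : ‖P.f‖ * ‖φ t‖ ≤ ‖P.f‖ * (2 * P.ℓ * ‖φ s₀‖) := by
    gcongr
    exact h.norm_le hnrm hst
  have h2 : (P.c + ‖P.f‖ * P.B) * (8 * P.ℓ ^ 2 / P.δ * ‖φ s₀‖) ≤ (P.c + ‖P.f‖ * P.B) * A := by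
    linarith
  have h3 : 8 * P.ℓ ^ 2 / P.δ * ‖φ s₀‖ ≤ A := le_of_mul_le_mul_left h2 (by positivity)
  have h4 : 4 * P.ℓ ≤ (2 * P.ℓ * ‖φ s₀‖)⁻¹ * P.δ * A := by
    calc 4 * P.ℓ = (2 * P.ℓ * ‖φ s₀‖)⁻¹ * P.δ * (8 * P.ℓ ^ 2 / P.δ * ‖φ s₀‖) := by
          field_simp
          ring
      _ ≤ _ := by gcongr
  have h5 : 4 * P.ℓ * ‖φ t‖ ≤ 2 * P.ℓ * ‖φ s₀‖ := by
    refine le_trans ?_ hle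
    gcongr
    linarith
  have h6 : P.ℓ * (2 * ‖φ t‖) ≤ P.ℓ * ‖φ s₀‖ := by linarith
  linarith [le_of_mul_le_mul_left h6 (by linarith)]

/-- A controlled path reaches the vertex, and stays there, in time linear in its norm. -/
theorem exists_hitting_time (P : DriftData nrm d) (hnrm : ∀ i, ‖nrm i‖ = 1) :
    ∃ T₁ : ℝ, 0 ≤ T₁ ∧ ∀ (φ : ℝ → E n) (s₀ : ℝ), ControlledFrom P φ s₀ →
      ∀ t, s₀ + T₁ * ‖φ s₀‖ ≤ t → φ t = 0 := by
  have hB := P.B_nonneg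
  have hℓ := P.one_le_ℓ
  have hδ := P.δ_pos
  have hc := P.c_pos
  set S := (P.c + ‖P.f‖ * P.B) * (8 * P.ℓ ^ 2 / P.δ) + ‖P.f‖ * (2 * P.ℓ + 1) with hS
  have hS0 : 0 ≤ S := by positivity
  refine ⟨2 * (S / P.c), by positivity, fun φ s₀ h t ht => ?_⟩
  set R := S / P.c with hR
  have hR0 : 0 ≤ R := by positivity
  have hRS : P.c * R = S := by rw [hR]; field_simp
  set m := ‖φ s₀‖
  have hm : 0 ≤ m := norm_nonneg _
  -- Each halving takes time proportional to the current norm bound, so the total time is at most `2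
  -- * R * m`.
  have hiter : ∀ k : ℕ, ∃ u, s₀ ≤ u ∧ u ≤ s₀ + 2 * R * m * (1 - (1 / 2) ^ k) ∧
      ‖φ u‖ ≤ m * (1 / 2) ^ k := by
    intro k
    induction k with
    | zero => exact ⟨s₀, le_rfl, by simp, by simp [m]⟩
    | succ k ih =>
      obtain ⟨u, hu, hu', hφu⟩ := ih
      have hq : 0 ≤ R * (m * (1 / 2) ^ k) := by positivity
      refine ⟨u + R * (m * (1 / 2) ^ k), by linarith, ?_, ?_⟩
      · rw [pow_succ]
        linarith
      · have h1 := (h.mono hu).norm_le_half hnrm (t := u + R * (m * (1 / 2) ^ k)) (by linarith) (by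
          rw [← hS, add_sub_cancel_left, ← mul_assoc, hRS]
          gcongr)
        rw [pow_succ]
        linarith
  have hbound : ∀ k : ℕ, ‖φ t‖ ≤ 2 * P.ℓ * m * (1 / 2) ^ k := by
    intro k
    obtain ⟨u, hu, hu', hφu⟩ := hiter k
    have h1 : 0 ≤ 2 * R * m * (1 / 2) ^ k := by positivity
    have h2 := (h.mono hu).norm_le hnrm (t := t) (by linarith)
    calc ‖φ t‖ ≤ 2 * P.ℓ * ‖φ u‖ := h2
      _ ≤ 2 * P.ℓ * (m * (1 / 2) ^ k) := by gcongr
      _ = _ := by ring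
  have hlim : Tendsto (fun k : ℕ => 2 * P.ℓ * m * (1 / 2 : ℝ) ^ k) atTop (𝓝 0) := by
    simpa using (tendsto_pow_atTop_nhds_zero_of_lt_one (r := (1 / 2 : ℝ)) (by norm_num)
      (by norm_num)).const_mul (2 * P.ℓ * m)
  exact norm_le_zero_iff.1 (ge_of_tendsto' hlim hbound)

end ControlledFrom

/-! ### Solutions of the smoothed differential inclusion -/

theorem exists_pos_le_of_finite {ι : Type*} [Finite ι] (p : ι → Prop) (F : ι → ℝ)
    (h : ∀ i, p i → 0 < F i) : ∃ c : ℝ, 0 < c ∧ ∀ i, p i → c ≤ F i := by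
  classical
  have := Fintype.ofFinite ι
  rcases (Finset.univ.filter p).eq_empty_or_nonempty with he | hne
  · refine ⟨1, one_pos, fun i hi => ?_⟩
    have : i ∈ Finset.univ.filter p := by simp [hi]
    simp [he] at this
  · obtain ⟨i, hi, hmin⟩ := Finset.exists_min_image _ F hne
    exact ⟨F i, h i (Finset.mem_filter.1 hi).2, fun j hj => hmin j (by simp [hj])⟩

/-- A compact subset of the interior of a convex set is contained in a compact convex set with the
same property, quantitatively. -/
theorem exists_compact_convex_enlargement {C₁ C : Set (E n)} (hC : Convex ℝ C) (h₁ : IsCompact C₁)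
    (h : C₁ ⊆ interior C) :
    ∃ (K : Set (E n)) (δ : ℝ), IsCompact K ∧ Convex ℝ K ∧ C₁ ⊆ K ∧ 0 < δ ∧
      ∀ β ∈ K, ∀ w, ‖w‖ ≤ δ → β + w ∈ C := by
  obtain ⟨δ, hδ, hsub⟩ := h₁.exists_cthickening_subset_open isOpen_interior h
  have hconv : Convex ℝ {β : E n | ∀ w, ‖w‖ ≤ δ → β + w ∈ C} := by
    intro x hx y hy a b ha hb hab w hw
    have h1 : a • x + b • y + w = a • (x + w) + b • (y + w) := by
      calc a • x + b • y + w = a • x + b • y + (a + b) • w := by rw [hab, one_smul]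
        _ = _ := by module
    rw [h1]
    exact hC (hx w hw) (hy w hw) ha hb hab
  have hhull : convexHull ℝ C₁ ⊆ {β : E n | ∀ w, ‖w‖ ≤ δ → β + w ∈ C} :=
    convexHull_min (fun β hβ w hw => interior_subset (hsub
      (Metric.mem_cthickening_of_dist_le _ β δ C₁ hβ (by simpa [dist_eq_norm] using hw)))) hconv
  -- Half of `δ` is spent on passing from the hull to its closure.
  refine ⟨closure (convexHull ℝ C₁), δ / 2,
    Metric.isCompact_of_isClosed_isBounded isClosed_closure
      (isBounded_convexHull.2 h₁.isBounded).closure,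
    (convex_convexHull ℝ C₁).closure, (subset_convexHull ℝ C₁).trans subset_closure,
    by positivity, fun β hβ w hw => ?_⟩
  obtain ⟨β', hβ', hdist⟩ := Metric.mem_closure_iff.1 hβ (δ / 2) (by positivity)
  have h1 : β + w = β' + (β - β' + w) := by abel
  rw [h1]
  refine hhull hβ' _ ((norm_add_le _ _).trans ?_)
  rw [dist_eq_norm] at hdist
  linarith

/-- A functional bounded below on the reaction directions is positive on the `d^λ`. -/
theorem functional_dl_pos {nrm d : Fin N → E n} {dl : Finset (Fin N) → E n}
    (hdl : ∀ lam : Finset (Fin N), lam.Nonempty →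
      dl lam ∈ coneGen d lam ∧ ∀ i ∈ lam, 0 < inner ℝ (dl lam) (nrm i))
    {f : E n →L[ℝ] ℝ} (hf : ∀ i, 0 < f (d i)) (s : Finset (Fin N)) (hs : s.Nonempty) :
    0 < f (dl s) := by
  obtain ⟨⟨α, hα, he⟩, hpos⟩ := hdl s hs
  rw [he, map_sum]
  simp only [map_smul, smul_eq_mul]
  refine Finset.sum_pos' (fun i hi => mul_nonneg (hα i hi) (hf i).le) ?_
  by_contra! hcon
  have h0 : dl s = 0 := by
    rw [he]
    refine Finset.sum_eq_zero fun i hi => ?_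
    have h1 : α i = 0 := le_antisymm (nonpos_of_mul_nonpos_left (hcon i hi) (hf i)) (hα i hi)
    rw [h1, zero_smul]
  obtain ⟨k, hk⟩ := hs
  have := hpos k hk
  rw [h0, inner_zero_left] at this
  exact lt_irrefl _ this

/-! ### Speed bounds and approach to the cone -/

namespace SolvesInclusion

variable {V : E n → Set (E n)} {φ : ℝ → E n}

theorem absolutelyContinuous (h : SolvesInclusion V φ) {s t : ℝ} (hs : 0 ≤ s) (hst : s ≤ t) :
    AbsolutelyContinuousOnInterval φ s t := by
  refine (h.1 t (hs.trans hst)).mono ?_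
  rw [uIcc_of_le hst, uIcc_of_le (hs.trans hst)]
  exact Icc_subset_Icc_left hs

theorem ae_hasDerivAt (h : SolvesInclusion V φ) {s t : ℝ} (hs : 0 ≤ s) :
    ∀ᵐ u ∂volume.restrict (Icc s t), ∃ v, HasDerivAt φ v u ∧ v ∈ V (φ u) := by
  have hsub : Icc s t ⊆ Ici 0 := fun u hu => hs.trans hu.1
  filter_upwards [ae_restrict_of_ae_restrict_of_subset hsub h.2] with u ⟨v, hv, hd⟩
  exact ⟨v, hd, hv⟩

theorem nonempty (h : SolvesInclusion V φ) : ∃ x, (V x).Nonempty := by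
  have hne : (ae (volume.restrict (Ici (0 : ℝ)))).NeBot := by
    rw [ae_neBot, Ne, Measure.restrict_eq_zero, Real.volume_Ici]
    exact ENNReal.top_ne_zero
  obtain ⟨t, u, hu, -⟩ := h.2.exists
  exact ⟨_, u, hu⟩

theorem norm_sub_le (h : SolvesInclusion V φ) {B : ℝ} (hB : 0 ≤ B) (hV : ∀ x, ∀ v ∈ V x, ‖v‖ ≤ B)
    {s t : ℝ} (hs : 0 ≤ s) (hst : s ≤ t) : ‖φ t - φ s‖ ≤ B * (t - s) := by
  obtain ⟨w, hw, he⟩ := exists_increment_eq_smul hst (h.absolutelyContinuous hs hst)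
    (convex_closedBall (0 : E n) B) Metric.isClosed_closedBall ⟨0, by simpa using hB⟩ (by
      filter_upwards [h.ae_hasDerivAt hs] with u ⟨v, hd, hv⟩
      exact ⟨v, hd, by simpa using hV _ v hv⟩)
  rw [he, norm_smul, Real.norm_of_nonneg (sub_nonneg.2 hst), mul_comm]
  have : ‖w‖ ≤ B := by simpa using hw
  have := sub_nonneg.2 hst
  gcongr

theorem inner_increment (h : SolvesInclusion V φ) {ν : E n} {ε c : ℝ}
    (hV : ∀ x, inner ℝ x ν < -(ε * ‖x‖) → ∀ v ∈ V x, c ≤ inner ℝ v ν) {s t : ℝ} (hs : 0 ≤ s)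
    (hst : s ≤ t) (hout : ∀ u ∈ Ioc s t, inner ℝ (φ u) ν < -(ε * ‖φ u‖)) :
    c * (t - s) ≤ inner ℝ (φ t) ν - inner ℝ (φ s) ν := by
  -- The left endpoint is null, so `s` may be an exit time still inside the region.
  have hne : ∀ᵐ u ∂volume.restrict (Icc s t), u ≠ s :=
    ae_restrict_of_ae (compl_mem_ae_iff.2 (measure_singleton s))
  have key := mul_sub_le_of_absolutelyContinuous hst
    (absolutelyContinuousOnInterval_clm (h.absolutelyContinuous hs hst) (innerSL ℝ ν)) (c := c) (by
      filter_upwards [h.ae_hasDerivAt hs, hne, ae_restrict_mem measurableSet_Icc]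
        with u ⟨v, hd, hv⟩ hu hmem
      refine ⟨innerSL ℝ ν v, (innerSL ℝ ν).hasFDerivAt.comp_hasDerivAt u hd, ?_⟩
      rw [innerSL_apply_apply, real_inner_comm]
      exact hV _ (hout u ⟨lt_of_le_of_ne hmem.1 hu.symm, hmem.2⟩) v hv)
  simpa only [innerSL_apply_apply, real_inner_comm] using key

/-- The region `{x : x · ν ≥ - ε |x|}` is invariant if the velocities outside push towards it
at a sufficient rate. -/
theorem near_invariant (h : SolvesInclusion V φ) {ν : E n} {ε c B : ℝ} (hε : 0 ≤ ε) (hB : 0 ≤ B)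
    (hεB : ε * B ≤ c) (hVB : ∀ x, ∀ v ∈ V x, ‖v‖ ≤ B)
    (hV : ∀ x, inner ℝ x ν < -(ε * ‖x‖) → ∀ v ∈ V x, c ≤ inner ℝ v ν) {s t : ℝ} (hs : 0 ≤ s)
    (hst : s ≤ t) (hnear : -(ε * ‖φ s‖) ≤ inner ℝ (φ s) ν) :
    -(ε * ‖φ t‖) ≤ inner ℝ (φ t) ν := by
  by_contra hcon
  have hcont : ContinuousOn φ (Icc s t) := by
    have := (h.absolutelyContinuous hs hst).continuousOn
    rwa [uIcc_of_le hst] at this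
  have hcl : IsCompact (Icc s t ∩ φ ⁻¹' {x | -(ε * ‖x‖) ≤ inner ℝ x ν}) :=
    isCompact_Icc.of_isClosed_subset
      (hcont.preimage_isClosed_of_isClosed isClosed_Icc
        (isClosed_le (by fun_prop) (continuous_id.inner continuous_const))) inter_subset_left
  -- After the last time `z` in the region the inner product gains at least `c * (t - z)`, while `ε
  -- * ‖φ‖` loses at most `ε * B * (t - z)`, which is no more.
  obtain ⟨z, ⟨hz, hzn⟩, hzmax⟩ := hcl.exists_isGreatest ⟨s, ⟨le_rfl, hst⟩, hnear⟩
  have hzn : -(ε * ‖φ z‖) ≤ inner ℝ (φ z) ν := hzn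
  have h0z : 0 ≤ z := hs.trans hz.1
  have hinc := h.inner_increment hV h0z hz.2 fun u hu => by
    by_contra hu'
    have := hzmax ⟨⟨hz.1.trans hu.1.le, hu.2⟩, not_lt.1 hu'⟩
    exact this.not_gt hu.1
  have h1 := h.norm_sub_le hB hVB h0z hz.2
  have h2 : ‖φ z‖ ≤ ‖φ t‖ + B * (t - z) := by
    have := norm_sub_norm_le (φ z) (φ t)
    rw [norm_sub_rev] at this
    linarith
  have h3 : ε * ‖φ z‖ ≤ ε * (‖φ t‖ + B * (t - z)) := by gcongr
  have h4 : ε * B * (t - z) ≤ c * (t - z) :=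
    mul_le_mul_of_nonneg_right hεB (sub_nonneg.2 hz.2)
  apply hcon
  linarith

/-- By invariance, being outside at time `t` means being outside since time `0`. The inner product,
initially at least `-‖φ 0‖`, would then have become nonnegative. -/
theorem near_of_le (h : SolvesInclusion V φ) {ν : E n} (hν : ‖ν‖ = 1) {ε c B : ℝ} (hε : 0 ≤ ε)
    (hB : 0 ≤ B) (hc : 0 < c) (hεB : ε * B ≤ c) (hVB : ∀ x, ∀ v ∈ V x, ‖v‖ ≤ B)
    (hV : ∀ x, inner ℝ x ν < -(ε * ‖x‖) → ∀ v ∈ V x, c ≤ inner ℝ v ν) {t : ℝ}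
    (ht : ‖φ 0‖ / c ≤ t) : -(ε * ‖φ t‖) ≤ inner ℝ (φ t) ν := by
  have ht0 : 0 ≤ t := le_trans (by positivity) ht
  by_contra hcon
  have hout : ∀ u ∈ Ioc 0 t, inner ℝ (φ u) ν < -(ε * ‖φ u‖) := by
    intro u hu
    by_contra hu'
    exact hcon (h.near_invariant hε hB hεB hVB hV hu.1.le hu.2 (not_lt.1 hu'))
  have hinc := h.inner_increment hV le_rfl ht0 hout
  have h1 := (abs_le.1 (abs_real_inner_le_norm (φ 0) ν)).1
  rw [hν, mul_one] at h1
  rw [div_le_iff₀ hc] at ht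
  have h2 : 0 ≤ ε * ‖φ t‖ := by positivity
  apply hcon
  linarith

end SolvesInclusion

/-- Uniform linear bounds for the solutions of the smoothed inclusion and for their hitting time of
the vertex. -/
theorem exists_linear_bounds {nrm d : Fin N → E n} (hnrm : ∀ i, ‖nrm i‖ = 1)
    {dl : Finset (Fin N) → E n}
    (hdl : ∀ lam : Finset (Fin N), lam.Nonempty →
      dl lam ∈ coneGen d lam ∧ ∀ i ∈ lam, 0 < inner ℝ (dl lam) (nrm i))
    (hreg : SkorohodRegular nrm d) {C₁ : Set (E n)} (hC₁ : IsCompact C₁)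
    (hC₁C : C₁ ⊆ interior (stabilityCone d)) (hne : C₁.Nonempty) {ρ : E n → ℝ}
    (hρ : Continuous ρ) (hρ0 : ∀ x, 0 ≤ ρ x) (hρs : tsupport ρ ⊆ Metric.closedBall 0 1)
    (hρ1 : ∫ x, ρ x = 1) {g : ℝ → ℝ} (hg01 : ∀ z, g z ∈ Icc (0 : ℝ) 1)
    (hg0 : ∀ z, 1 ≤ z → g z = 0) :
    ∃ a₀ T C : ℝ, 0 < a₀ ∧ 0 < T ∧ 1 < C ∧ ∀ a, 0 < a → a < a₀ → ∀ φ : ℝ → E n,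
      SolvesInclusion (velSet nrm d dl ρ g C₁ a) φ →
      (∀ t, T * ‖φ 0‖ ≤ t → φ t = 0) ∧ ∀ t, 0 ≤ t → ‖φ t‖ ≤ C * ‖φ 0‖ := by
  obtain ⟨K, δ, hK, hKc, hCK, hδ, hKδ⟩ :=
    exists_compact_convex_enlargement (convex_coneGen _ _) hC₁ hC₁C
  obtain ⟨f, c₀, hc₀, hfd⟩ := exists_functional_pos hdl
  obtain ⟨c₂, hc₂, hfdl⟩ := exists_pos_le_of_finite (fun s : Finset (Fin N) => s.Nonempty)
    (fun s => f (dl s)) (functional_dl_pos hdl fun i => hc₀.trans_le (hfd i))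
  obtain ⟨c₁, hc₁, hdln⟩ := exists_pos_le_of_finite
    (fun q : Finset (Fin N) × Fin N => q.2 ∈ q.1) (fun q => inner ℝ (dl q.1) (nrm q.2))
    (fun q hq => (hdl q.1 ⟨_, hq⟩).2 _ hq)
  obtain ⟨ℓ, hℓ, hdisc⟩ := hreg.exists_discrete_bound hnrm
  obtain ⟨κ, hκ, happ⟩ := exists_face_approx_uniform nrm (ε := (4 * ℓ)⁻¹) (by positivity)
  obtain ⟨B, hB⟩ := (hK.union (localGen_finite d dl Finset.univ).isCompact).isBounded.exists_norm_le
  have hKn : K.Nonempty := hne.mono hCK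
  have hB0 : 0 ≤ B := by
    obtain ⟨β, hβ⟩ := hKn
    exact (norm_nonneg β).trans (hB β (Or.inl hβ))
  set P : DriftData nrm d :=
    { K := K, f := f, c := min c₀ c₂, δ := δ, B := B, ℓ := ℓ, κ := κ
      c_pos := lt_min hc₀ hc₂
      δ_pos := hδ
      B_nonneg := hB0
      one_le_ℓ := hℓ
      κ_pos := hκ
      norm_le := fun β hβ => hB β (Or.inl hβ)
      add_mem := hKδ
      discrete_bound := hdisc
      face_approx := happ } with hP
  obtain ⟨T₁, hT₁, hhit⟩ := ControlledFrom.exists_hitting_time P hnrm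
  -- The bound by `κ` gives the closeness required in `ControlledFrom`; the other makes the layer
  -- invariant.
  set ε := min κ (c₁ / (B + 1)) with hε
  have hε0 : 0 < ε := lt_min hκ (by positivity)
  have hεB : ε * B ≤ c₁ := by
    have h1 : ε * (B + 1) ≤ c₁ := by
      rw [← le_div_iff₀ (by positivity)]
      exact min_le_right _ _
    linarith
  have hBc : 0 ≤ B / c₁ := by positivity
  -- Here `a < ε` gives the inward push outside the layer and `a < κ / 2` the localization to nearly
  -- active constraints. The term `1 / c₁` pays for reaching the layer, during which the norm grows
  -- at most by the factor `1 + B / c₁`.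
  refine ⟨min ε (κ / 2), 1 / c₁ + T₁ * (1 + B / c₁), 2 * ℓ * (1 + B / c₁), by positivity,
    by positivity, by nlinarith, fun a ha haa φ hφ => ?_⟩
  have haε : a < ε := haa.trans_le (min_le_left _ _)
  have haκ : a < κ / 2 := haa.trans_le (min_le_right _ _)
  have hVB : ∀ x, ∀ v ∈ velSet nrm d dl ρ g C₁ a x, ‖v‖ ≤ B := by
    intro x v hv
    rcases eq_or_ne x 0 with rfl | hx
    · have h0 : v = 0 := velSet_zero_subset hv
      rw [h0, norm_zero]
      exact hB0
    · have h1 := velSet_subset_convexHull hnrm hρ hρ0 hρs hρ1 hg01 hg0 hK hKc hCK ha hx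
        (I := Finset.univ) (fun i _ => Finset.mem_univ i) hv
      have h2 := convexHull_min (t := Metric.closedBall (0 : E n) B)
        (fun w hw => by simpa using hB w hw) (convex_closedBall _ _) h1
      simpa using h2
  have hVin : ∀ i x, inner ℝ x (nrm i) < -(ε * ‖x‖) → ∀ v ∈ velSet nrm d dl ρ g C₁ a x,
      c₁ ≤ inner ℝ v (nrm i) := by
    intro i x hx v hv
    refine le_inner_of_mem_velSet hnrm hρ hρ0 hρs hρ1 hg01 hg0
      (fun s j hj => hdln (s, j) hj) ha (hx.trans_le ?_) hv
    have : a * ‖x‖ ≤ ε * ‖x‖ := by gcongr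
    linarith
  set τ := ‖φ 0‖ / c₁ with hτ
  have hτ0 : 0 ≤ τ := by positivity
  have hctrl : ControlledFrom P φ τ := by
    refine ⟨fun s t hs hst => hφ.norm_sub_le hB0 hVB (hτ0.trans hs) hst, fun u hu i => ?_,
      fun s t I hs hst hI => ?_⟩
    · have h1 := hφ.near_of_le (hnrm i) hε0.le hB0 hc₁ hεB hVB (hVin i) hu
      have h2 : ε * ‖φ u‖ ≤ κ * ‖φ u‖ := by gcongr; exact min_le_left _ _
      linarith
    · obtain ⟨w, hw, he⟩ := exists_increment_eq_smul hst
        (hφ.absolutelyContinuous (hτ0.trans hs) hst)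
        (convex_convexHull ℝ (K ∪ localGen d dl I))
        (isCompact_convexHull_union hK hKc (localGen_finite d dl I)).isClosed
        (hKn.mono (subset_union_left.trans (subset_convexHull ℝ _))) (by
          filter_upwards [hφ.ae_hasDerivAt (hτ0.trans hs), ae_restrict_mem measurableSet_Icc]
            with u ⟨v, hd, hv⟩ hu
          refine ⟨v, hd, velSet_subset_convexHull hnrm hρ hρ0 hρs hρ1 hg01 hg0 hK hKc hCK ha
            (hI u hu).1 (fun i hi => (hI u hu).2 i (hi.trans ?_)) hv⟩
          gcongr)
      have hQ : Convex ℝ {r : E n | r ∈ coneGen d I ∧ min c₀ c₂ ≤ f r} :=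
        (convex_coneGen d I).inter (convex_halfSpace_ge f.isLinear _)
      have hgen : localGen d dl I ⊆ {r : E n | r ∈ coneGen d I ∧ min c₀ c₂ ≤ f r} := by
        classical
        rintro _ (⟨i, hi, rfl⟩ | ⟨s, ⟨hs, hsI⟩, rfl⟩)
        · refine ⟨⟨fun j => if j = i then 1 else 0, fun j _ => ?_, ?_⟩,
            (min_le_left _ _).trans (hfd i)⟩
          · dsimp only
            split_ifs <;> norm_num
          · have hi' : i ∈ I := hi
            simp [ite_smul, hi']
        · exact ⟨coneGen_mono hsI (hdl s hs).1, (min_le_right _ _).trans (hfdl s hs)⟩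
      obtain ⟨σ, hσ, β, hβ, r, hr, rfl⟩ :=
        exists_decomposition_of_mem_convexHull_union hKc hKn hQ hgen hw
      refine ⟨σ, hσ, β, hβ, (1 - σ) • r, ?_, he, ?_⟩
      · rcases hr with ⟨rfl, rfl⟩ | hr
        · simpa using zero_mem_coneGen d I
        · exact smul_mem_coneGen (sub_nonneg.2 hσ.2) hr.1
      · rcases hr with ⟨rfl, rfl⟩ | hr
        · simp
        · rw [map_smul, smul_eq_mul]
          exact mul_le_mul_of_nonneg_left hr.2 (sub_nonneg.2 hσ.2)
  have hinit : ∀ t, 0 ≤ t → t ≤ τ → ‖φ t‖ ≤ (1 + B / c₁) * ‖φ 0‖ := by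
    intro t ht htτ
    have h1 := hφ.norm_sub_le hB0 hVB le_rfl ht
    have h2 := norm_sub_norm_le (φ t) (φ 0)
    have h3 : B * (t - 0) ≤ B * τ := by gcongr; linarith
    have h4 : B * τ = B / c₁ * ‖φ 0‖ := by rw [hτ]; ring
    linarith
  have hφτ := hinit τ hτ0 le_rfl
  constructor
  · intro t ht
    refine hhit φ τ hctrl t (le_trans ?_ ht)
    have h1 : T₁ * ‖φ τ‖ ≤ T₁ * ((1 + B / c₁) * ‖φ 0‖) := by gcongr
    have h2 : τ = 1 / c₁ * ‖φ 0‖ := by rw [hτ]; ring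
    linarith
  · intro t ht
    have h0 : 0 ≤ (1 + B / c₁) * ‖φ 0‖ := by positivity
    rcases le_total t τ with htτ | htτ
    · have h1 := hinit t ht htτ
      nlinarith
    · calc ‖φ t‖ ≤ 2 * ℓ * ‖φ τ‖ := hctrl.norm_le hnrm htτ
        _ ≤ 2 * ℓ * ((1 + B / c₁) * ‖φ 0‖) := by gcongr
        _ = _ := by ring

end ConstrainedCone

end

theorem proposition4p3 {n N : ℕ}
    -- the cone `G`, with unit normals `n_i`, and the unit constraint directions `d_i`
    (nrm d : Fin N → ConstrainedCone.E n)
    (hnrm : ∀ i, ‖nrm i‖ = 1)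
    (hvertex : ConstrainedCone.ProperVertex nrm)
    (hd : ∀ i, ‖d i‖ = 1)
    (hdn : ∀ i, 0 < inner ℝ (d i) (nrm i))
    -- the vectors `d^λ ∈ cone {d_i, i ∈ λ}`, one for each nonempty set `λ` of indices
    (dl : Finset (Fin N) → ConstrainedCone.E n)
    (hdl : ∀ lam : Finset (Fin N), lam.Nonempty →
      dl lam ∈ ConstrainedCone.coneGen d lam ∧ ∀ i ∈ lam, 0 < inner ℝ (dl lam) (nrm i))
    (hreg : ConstrainedCone.SkorohodRegular nrm d)
    -- the compact set `𝒞₁` in the interior of `𝒞`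
    (C₁ : Set (ConstrainedCone.E n)) (hC₁ : IsCompact C₁)
    (hC₁C : C₁ ⊆ interior (ConstrainedCone.stabilityCone d))
    -- the mollifier `ρ` and the cut-off function `g`
    (ρ : ConstrainedCone.E n → ℝ) (hρ : ContDiff ℝ ∞ ρ) (hρ0 : ∀ x, 0 ≤ ρ x)
    (hρs : tsupport ρ ⊆ Metric.closedBall 0 1) (hρ1 : ∫ x, ρ x = 1)
    (g : ℝ → ℝ) (hg : ContDiff ℝ ∞ g) (hg01 : ∀ z, g z ∈ Set.Icc (0 : ℝ) 1)
    (hg1 : ∀ z ∈ Set.Icc (0 : ℝ) (1 / 2), g z = 1) (hg0 : ∀ z, 1 ≤ z → g z = 0) :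
    ∃ a₀ T : ℝ, 0 < a₀ ∧ 0 < T ∧
      (∀ a : ℝ, 0 < a → a < a₀ → ∀ (m : ℤ) (φ : ℝ → ConstrainedCone.E n),
        ConstrainedCone.SolvesInclusion (ConstrainedCone.velSet nrm d dl ρ g C₁ a) φ →
        ‖φ 0‖ ≤ (2 : ℝ) ^ m →
        ∀ t : ℝ, (2 : ℝ) ^ (m + 1) * T ≤ t → φ t = 0) ∧
      ∃ r : ℝ, 0 < r ∧ r < 1 ∧
        ∀ a : ℝ, 0 < a → a < a₀ → ∀ φ : ℝ → ConstrainedCone.E n,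
          ConstrainedCone.SolvesInclusion (ConstrainedCone.velSet nrm d dl ρ g C₁ a) φ →
          ‖φ 0‖ ≤ r →
          ∀ t : ℝ, 0 ≤ t → ‖φ t‖ ≤ 1 := by
  -- With no drifts the velocity sets are empty and there are no solutions.
  rcases C₁.eq_empty_or_nonempty with rfl | hne
  · have hno : ∀ (a : ℝ) (φ : ℝ → ConstrainedCone.E n),
        ¬ ConstrainedCone.SolvesInclusion (ConstrainedCone.velSet nrm d dl ρ g ∅ a) φ := by
      intro a φ h
      obtain ⟨x, u, hu⟩ := h.nonempty
      simp [ConstrainedCone.velSet] at hu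
    exact ⟨1, 1, one_pos, one_pos, fun a _ _ _ φ h => absurd h (hno a φ), 1 / 2, by norm_num,
      by norm_num, fun a _ _ φ h => absurd h (hno a φ)⟩
  obtain ⟨a₀, T, C, ha₀, hT, hC, hbound⟩ := ConstrainedCone.exists_linear_bounds hnrm hdl hreg
    hC₁ hC₁C hne hρ.continuous hρ0 hρs hρ1 hg01 hg0
  refine ⟨a₀, T, ha₀, hT, fun a ha haa m φ hφ hm t ht => ?_, C⁻¹, by positivity,
    inv_lt_one_of_one_lt₀ hC, fun a ha haa φ hφ hr t ht => ?_⟩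
  · refine (hbound a ha haa φ hφ).1 t (le_trans ?_ ht)
    have h1 : (2 : ℝ) ^ m ≤ 2 ^ (m + 1) := zpow_le_zpow_right₀ one_le_two (by lia)
    rw [mul_comm]
    gcongr
    exact hm.trans h1
  · have hC0 : 0 < C := one_pos.trans hC
    refine ((hbound a ha haa φ hφ).2 t ht).trans ?_
    calc C * ‖φ 0‖ ≤ C * C⁻¹ := by gcongr
      _ = 1 := mul_inv_cancel₀ hC0.ne'
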